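/- Let $p$ be an odd prime and let $G$ be a finite group of exponent $p$ and nilpotency class at most two, i.e. $[G,G]\subseteq Z(G)$. Let $n=\operatorname{rank}(G/Z(G))$ and $m=\operatorname{rank}([G,G])$, where the rank of a finite group is the minimal number of generators. A group $G$ is called capable if $G\cong K/Z(K)$ for some group $K$. Define $f$ on positive integers by $$f\left(\binom{T}{2}+s\right)=\binom{T}{3}+\binom{s}{2},\qquad 0\le s\le T,$$ which is well defined, since every positive integer can be written as $\binom{T}{2}+s$ with $0\le s\le T$ and all such representations give the same value. Then: 1. (necessary condition) if $G$ is capable, then $n\le 2m+\binom{m}{2}$; 2. (sufficient condition) if $f\left(\binom{n}{2}-m+1\right)<n$, then $G$ is capable. (Here $m\le\binom{n}{2}$ always holds, so $\binom{n}{2}-m+1$ is a positive integer.) -/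

import Mathlib

/-- A group `G` is capable if it is isomorphic to `K / Z(K)` for some group `K`. -/
def IsCapable.{u} (G : Type u) [Group G] : Prop :=
  ∃ (K : Type u) (_ : Group K), Nonempty (G ≃* K ⧸ Subgroup.center K)

/-- The largest `T` with `T.choose 2 ≤ k`. -/
def triangularRoot (k : ℕ) : ℕ :=
  Nat.findGreatest (fun t => t.choose 2 ≤ k) (k + 1)

/-- The function `f` with `f (T.choose 2 + s) = T.choose 3 + s.choose 2` for `0 ≤ s ≤ T`;
`overlapBound_eq` below shows that this holds for every such representation. -/
def overlapBound (k : ℕ) : ℕ :=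
  (triangularRoot k).choose 3 + (k - (triangularRoot k).choose 2).choose 2

theorem le_choose_two_succ (t : ℕ) : t ≤ (t + 1).choose 2 := by
  rw [Nat.choose_succ_succ' t 1, Nat.choose_one_right]
  exact Nat.le_add_right _ _

theorem triangularRoot_eq (T s : ℕ) (hT : 0 < T) (hs : s < T) :
    triangularRoot (T.choose 2 + s) = T := by
  unfold triangularRoot
  rw [Nat.findGreatest_eq_iff]
  refine ⟨?_, fun _ => Nat.le_add_right _ _, ?_⟩
  · obtain ⟨t, rfl⟩ : ∃ t, T = t + 1 := ⟨T - 1, by omega⟩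
    have := le_choose_two_succ t
    omega
  · intro n hn _ h
    have h1 : (T + 1).choose 2 ≤ n.choose 2 := Nat.choose_le_choose 2 hn
    rw [Nat.choose_succ_succ' T 1, Nat.choose_one_right] at h1
    simp only [Nat.reduceAdd] at h1
    omega

theorem overlapBound_eq (T s : ℕ) (hs : s ≤ T) :
    overlapBound (T.choose 2 + s) = T.choose 3 + s.choose 2 := by
  rcases Nat.lt_or_eq_of_le hs with h | rfl
  · simp only [overlapBound, triangularRoot_eq T s (by omega) h, Nat.add_sub_cancel_left]
  · have e : s.choose 2 + s = (s + 1).choose 2 + 0 := by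
      rw [Nat.choose_succ_succ' s 1, Nat.choose_one_right]
      simp only [Nat.reduceAdd]
      omega
    have e3 : (s + 1).choose 3 = s.choose 2 + s.choose 3 := Nat.choose_succ_succ' s 2
    rw [e]
    simp only [overlapBound, triangularRoot_eq (s + 1) 0 (by omega) (by omega)]
    simp [e3, Nat.add_comm]

/-!
A group of class two and odd prime exponent `p` is the Heisenberg group of an alternating bilinear
map `β : V × V → W` over `ZMod p` with trivial radical (Baer's correspondence). The argument
replaces capability by linear algebra: a capable Heisenberg group has, for every nonzero `w` in the
span `U` of the values of `β`, a form `τ : W × V → ZMod p` that does not kill `w` and satisfies the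
Jacobi identity `τ (β a b) c + τ (β b c) a + τ (β c a) b = 0`; conversely such forms for all nonzero
`w : W` make the group capable. From a capability witness `K → G` with kernel the center, `τ` is
read off from commutators in `K`. Conversely the Jacobi identity makes the trilinear form
`τ (β x y) z` a coboundary, and a primitive corrects `τ` to a `2`-cocycle of the Heisenberg group;
in the resulting central extension no lift of `w` is central.

Necessity: intersect `U` successively with the kernels of Jacobi forms. Suppose that the current
subspace `S` has codimension `k` in `U` and that `τ` cuts it down by `r ≥ 1` dimensions. Among the
vectors `c` with `β V c ⊆ S`, the equation `τ U c = 0` imposes at most `k + r` conditions, and it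
makes `τ (β a c) a'` symmetric in `a` and `a'`, so that another `(r + 1).choose 2` conditions force
`β V c ⊆ S ∩ ker τ`. With `m = dim U`, the total is
largest when every `r` is one, and is then `2 * m + m.choose 2`.

Sufficiency: if no Jacobi form detects `w`, then every map `φ ↦ φ u • w` on the dual of `V` is the
contraction of an alternating trivector whose contractions lie in the preimage of the line of `w`
under `⋀² V → W`. Passing to leading basis elements in colexicographic order turns trivectors with
contractions in a given space into a family of `3`-sets with a given shadow, so that the
Kruskal–Katona theorem bounds their dimension by `f`.
-/

open Finset
open scoped FinsetFamily

theorem exists_choose_two_add_eq (e : ℕ) : ∃ T s, 0 < T ∧ s < T ∧ T.choose 2 + s = e := by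
  induction e with
  | zero => exact ⟨1, 0, one_pos, one_pos, rfl⟩
  | succ e ih =>
    obtain ⟨T, s, hT, hs, rfl⟩ := ih
    rcases (show s + 1 ≤ T from hs).lt_or_eq with hs' | rfl
    · exact ⟨T, s + 1, hT, hs', rfl⟩
    · refine ⟨s + 2, 0, by omega, by omega, ?_⟩
      have : (s + 2).choose 2 = (s + 1) + (s + 1).choose 2 := by
        rw [Nat.choose_succ_succ' (s + 1) 1, Nat.choose_one_right]
      omega

theorem exists_overlapBound_eq (e : ℕ) :
    ∃ T s, 0 < s ∧ s < T ∧ e ≤ T.choose 2 + s ∧ overlapBound e = T.choose 3 + s.choose 2 := by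
  obtain ⟨T, s, hT, hs, rfl⟩ := exists_choose_two_add_eq e
  rw [overlapBound_eq T s hs.le]
  rcases Nat.eq_zero_or_pos s with rfl | hs0
  · rcases Nat.lt_or_eq_of_le (Nat.succ_le_of_lt hT) with hT1 | rfl
    · exact ⟨T, 1, one_pos, hT1, by omega, rfl⟩
    · exact ⟨2, 1, one_pos, one_lt_two, by decide, rfl⟩
  · exact ⟨T, s, hs0, hs, le_rfl, rfl⟩

theorem toColex_insert_le_toColex_insert {α : Type*} [LinearOrder α] {s t : Finset α} {c : α}
    (hs : c ∉ s) (ht : c ∉ t) :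
    toColex (insert c s) ≤ toColex (insert c t) ↔ toColex s ≤ toColex t := by
  rw [← Colex.toColex_sdiff_le_toColex_sdiff (u := {c}) (by simp) (by simp)]
  simp [sdiff_singleton_eq_erase, hs, ht]

theorem initSeg_insert {n : ℕ} {s : Finset (Fin n)} {c : Fin n} (hc : ∀ x ∈ s, x < c) :
    Colex.initSeg (insert c s) =
      powersetCard (#s + 1) (Iio c) ∪ (Colex.initSeg s).image (insert c) := by
  have hcs : c ∉ s := fun h ↦ (hc c h).false
  ext t
  simp only [Colex.mem_initSeg, card_insert_of_notMem hcs, mem_union, mem_powersetCard, mem_image]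
  constructor
  · rintro ⟨hcard, hle⟩
    have hlec : ∀ x ∈ t, x ≤ c := Colex.forall_le_mono hle (by simpa using fun x hx ↦ (hc x hx).le)
    by_cases hct : c ∈ t
    · refine .inr ⟨t.erase c, ⟨?_, ?_⟩, insert_erase hct⟩
      · rw [card_erase_of_mem hct, ← hcard, Nat.add_sub_cancel]
      · rwa [← toColex_insert_le_toColex_insert (notMem_erase c t) hcs, insert_erase hct]
    · refine .inl ⟨fun x hx ↦ mem_Iio.2 ((hlec x hx).lt_of_ne ?_), hcard.symm⟩
      exact fun h ↦ hct (h ▸ hx)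
  · rintro (⟨hsub, hcard⟩ | ⟨u, ⟨hcard, hle⟩, rfl⟩)
    · refine ⟨hcard.symm, (Colex.toColex_lt_singleton.2 fun x hx ↦ mem_Iio.1 (hsub hx)).le.trans ?_⟩
      exact Colex.toColex_le_toColex_of_subset (by simp)
    · have hcu : c ∉ u := fun h ↦ (Colex.forall_lt_mono hle hc c h).false
      exact ⟨by rw [card_insert_of_notMem hcu, hcard],
        (toColex_insert_le_toColex_insert hcu hcs).2 hle⟩

theorem card_initSeg_insert {n : ℕ} {s : Finset (Fin n)} {c : Fin n} (hc : ∀ x ∈ s, x < c) :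
    #(Colex.initSeg (insert c s)) = (c : ℕ).choose (#s + 1) + #(Colex.initSeg s) := by
  rw [initSeg_insert hc, card_union_of_disjoint, card_powersetCard, Fin.card_Iio,
    card_image_of_injOn]
  · intro u hu v hv huv
    have hnot {u : Finset (Fin n)} (hu : u ∈ Colex.initSeg s) : c ∉ u := fun h ↦
      (Colex.forall_lt_mono (Colex.mem_initSeg.1 hu).2 hc c h).false
    rw [← erase_insert (hnot hu), ← erase_insert (hnot hv), huv]
  · rw [disjoint_left]
    simp only [mem_powersetCard, mem_image, not_exists, not_and]
    rintro _ ⟨hsub, -⟩ u - rfl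
    exact (mem_Iio.1 (hsub (mem_insert_self c u))).false

theorem card_initSeg_singleton {n : ℕ} (a : Fin n) : #(Colex.initSeg {a}) = a + 1 := by
  have hempty : Colex.initSeg (∅ : Finset (Fin n)) = {∅} := by
    ext t
    simp +contextual [eq_comm (a := 0)]
  rw [← insert_empty_eq a, card_initSeg_insert (by simp), hempty, card_singleton, card_empty,
    zero_add, Nat.choose_one_right]

theorem exists_card_initSeg_eq {n T s : ℕ} (hs : 0 < s) (hsT : s < T) (hTn : T < n) :
    ∃ t : Finset (Fin n), #t = 3 ∧ #(Colex.initSeg t) = T.choose 3 + s.choose 2 + 1 ∧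
      #(∂ (Colex.initSeg t)) = T.choose 2 + s + 1 := by
  let a : Fin n := ⟨0, by omega⟩
  let b : Fin n := ⟨s, by omega⟩
  let c : Fin n := ⟨T, hTn⟩
  have hab : a < b := hs
  have hbc : b < c := hsT
  have hac : a < c := hab.trans hbc
  refine ⟨{c, b, a}, card_eq_three.2 ⟨c, b, a, hbc.ne', hac.ne', hab.ne', rfl⟩, ?_, ?_⟩
  · rw [card_initSeg_insert (by simp [hbc, hac]), card_initSeg_insert (by simpa using hab),
      card_initSeg_singleton, card_pair hab.ne']
    simp only [a, b, c, card_singleton, zero_add, add_assoc]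
  · have hmin : min' {c, b, a} (insert_nonempty ..) = a :=
      le_antisymm (min'_le _ _ (by simp)) (le_min' _ _ _ (by simp [hac.le, hab.le]))
    have herase : ({c, b, a} : Finset (Fin n)).erase a = {c, b} := by
      ext x
      simp only [mem_erase, mem_insert, mem_singleton]
      grind
    rw [Colex.shadow_initSeg (insert_nonempty ..), hmin, herase,
      card_initSeg_insert (by simpa using hbc), card_initSeg_singleton, card_singleton]
    simp only [b, c, add_assoc]

theorem card_le_overlapBound_of_card_shadow_le {n e : ℕ} {𝒜 : Finset (Finset (Fin n))}
    (h𝒜 : (𝒜 : Set (Finset (Fin n))).Sized 3) (he : #(∂ 𝒜) ≤ e) : #𝒜 ≤ overlapBound e := by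
  obtain ⟨T, s, hs, hsT, heT, hbound⟩ := exists_overlapBound_eq e
  rw [hbound]
  by_contra! hlt
  rcases le_or_gt n T with hnT | hTn
  · have hcard : #𝒜 ≤ n.choose 3 := by simpa using h𝒜.card_le
    have := Nat.choose_le_choose 3 hnT
    omega
  · obtain ⟨t, ht, hcard, hshadow⟩ := exists_card_initSeg_eq hs hsT hTn
    have := kruskal_katona h𝒜 (hcard.trans_le hlt) (ht ▸ Colex.isInitSeg_initSeg)
    omega

open Module

section LeadingSets

variable {F V : Type*} [Field F] [AddCommGroup V] [Module F V] {n k : ℕ}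

instance finiteDimensional_alternatingMap [FiniteDimensional F V] :
    FiniteDimensional F (V [⋀^Fin k]→ₗ[F] F) :=
  Module.Finite.equiv exteriorPower.alternatingMapLinearEquiv.symm

theorem finrank_alternatingMap [FiniteDimensional F V] :
    finrank F (V [⋀^Fin k]→ₗ[F] F) = (finrank F V).choose k := by
  rw [exteriorPower.alternatingMapLinearEquiv.finrank_eq, Subspace.dual_finrank_eq,
    exteriorPower.finrank_eq]

/-- The `k`-sets that occur as colexicographically largest set `S` on which some form in `Y` does
not vanish; a form is evaluated on `S` by listing the basis vectors indexed by `S` in any order. -/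
noncomputable def leadingSets (b : Basis (Fin n) F V) (Y : Submodule F (V [⋀^Fin k]→ₗ[F] F)) :
    Finset (Finset (Fin n)) :=
  open Classical in
  {S | ∃ y ∈ Y, ∃ v : Fin k → Fin n, univ.image v = S ∧ y (b ∘ v) ≠ 0 ∧
    ∀ u : Fin k → Fin n, toColex S < toColex (univ.image u) → y (b ∘ u) = 0}

variable {b : Basis (Fin n) F V}

theorem mem_leadingSets {Y : Submodule F (V [⋀^Fin k]→ₗ[F] F)} {S : Finset (Fin n)} :
    S ∈ leadingSets b Y ↔ ∃ y ∈ Y, ∃ v : Fin k → Fin n, univ.image v = S ∧ y (b ∘ v) ≠ 0 ∧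
      ∀ u : Fin k → Fin n, toColex S < toColex (univ.image u) → y (b ∘ u) = 0 := by
  simp [leadingSets]

theorem injective_of_map_basis_ne_zero {y : V [⋀^Fin k]→ₗ[F] F} {v : Fin k → Fin n}
    (hv : y (b ∘ v) ≠ 0) : Function.Injective v := by
  by_contra h
  exact hv (y.map_eq_zero_of_not_injective _ fun hbv ↦ h hbv.of_comp)

theorem map_basis_ne_zero_of_image_eq {y : V [⋀^Fin k]→ₗ[F] F} {u v : Fin k → Fin n}
    (hv : y (b ∘ v) ≠ 0) (hu : Function.Injective u) (huv : univ.image u = univ.image v) :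
    y (b ∘ u) ≠ 0 := by
  have hv' := injective_of_map_basis_ne_zero hv
  have hrange : Set.range u = Set.range v := by simpa using congrArg (SetLike.coe) huv
  let σ : Equiv.Perm (Fin k) := (Equiv.ofInjective u hu).trans
    ((Equiv.setCongr hrange).trans (Equiv.ofInjective v hv').symm)
  have hσ : b ∘ u = (b ∘ v) ∘ σ := by
    funext i
    simp [σ, Equiv.apply_ofInjective_symm]
  rw [hσ, y.map_perm]
  rcases Int.units_eq_one_or (Equiv.Perm.sign σ) with h | h <;> simpa [h] using hv

theorem sized_leadingSets (Y : Submodule F (V [⋀^Fin k]→ₗ[F] F)) :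
    (leadingSets b Y : Set (Finset (Fin n))).Sized k := by
  intro S hS
  obtain ⟨y, -, v, rfl, hv, -⟩ := mem_leadingSets.1 hS
  rw [card_image_of_injective _ (injective_of_map_basis_ne_zero hv), card_univ, Fintype.card_fin]

theorem exists_leadingSet {y : V [⋀^Fin k]→ₗ[F] F} (hy : y ≠ 0) (b : Basis (Fin n) F V) :
    ∃ v : Fin k → Fin n, y (b ∘ v) ≠ 0 ∧
      ∀ u : Fin k → Fin n, toColex (univ.image v) < toColex (univ.image u) → y (b ∘ u) = 0 := by
  have hne : {v : Fin k → Fin n | y (b ∘ v) ≠ 0}.Nonempty := by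
    by_contra! h
    refine hy (Basis.ext_alternating b fun v _ ↦ ?_)
    by_contra hv
    exact (h ▸ hv : v ∈ (∅ : Set _))
  obtain ⟨v, hv, hmax⟩ :=
    (Set.toFinite _).exists_maximalFor (fun v ↦ toColex (univ.image v)) _ hne
  refine ⟨v, hv, fun u hu ↦ ?_⟩
  by_contra hyu
  exact (hmax hyu hu.le).not_gt hu

theorem finrank_le_card_leadingSets (Y : Submodule F (V [⋀^Fin k]→ₗ[F] F)) :
    finrank F Y ≤ #(leadingSets b Y) := by
  choose _ _ v hvS hv _ using fun S : leadingSets b Y ↦ mem_leadingSets.1 S.2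
  let eval : Y →ₗ[F] (leadingSets b Y → F) :=
    { toFun := fun z S ↦ z.1 (b ∘ v S)
      map_add' := fun _ _ ↦ rfl
      map_smul' := fun _ _ ↦ rfl }
  have heval : Function.Injective eval := by
    rw [injective_iff_map_eq_zero]
    intro z hz
    by_contra hne
    obtain ⟨u, hu, hlead⟩ := exists_leadingSet (fun h ↦ hne (Subtype.ext h)) b
    let S : leadingSets b Y := ⟨univ.image u, mem_leadingSets.2 ⟨z, z.2, u, rfl, hu, hlead⟩⟩
    exact map_basis_ne_zero_of_image_eq hu (injective_of_map_basis_ne_zero (hv S)) (hvS S)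
      (congrFun hz S)
  simpa using LinearMap.finrank_le_finrank_of_injective heval

theorem card_leadingSets_le_finrank (Y : Submodule F (V [⋀^Fin k]→ₗ[F] F)) [FiniteDimensional F Y] :
    #(leadingSets b Y) ≤ finrank F Y := by
  choose y hyY v hvS hv hu using fun S : leadingSets b Y ↦ mem_leadingSets.1 S.2
  have hindep : LinearIndependent F fun S ↦ (⟨y S, hyY S⟩ : Y) := by
    refine (Fintype.linearIndependent_iff (M := Y)).2 fun g hg ↦ ?_
    by_contra! hne
    obtain ⟨S, hS, hmax⟩ :=
      (Set.toFinite {S | g S ≠ 0}).exists_maximalFor (fun S ↦ toColex S.1) _ hne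
    let eval : Y →ₗ[F] F :=
      { toFun := fun z ↦ z.1 (b ∘ v S)
        map_add' := fun _ _ ↦ rfl
        map_smul' := fun _ _ ↦ rfl }
    have heval : ∑ T, g T • y T (b ∘ v S) = 0 := by
      rw [← map_zero eval, ← hg, map_sum]
      rfl
    rw [Finset.sum_eq_single S ?_ (by simp)] at heval
    · exact smul_ne_zero hS (hv S) heval
    · intro T _ hTS
      by_cases hgT : g T = 0
      · rw [hgT, zero_smul]
      · have hne : toColex T.1 ≠ toColex S.1 := fun h ↦ hTS (Subtype.ext (toColex.injective h))
        have hlt : toColex T.1 < toColex S.1 :=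
          ((le_total _ _).elim id (hmax hgT)).lt_of_ne hne
        rw [hu T _ (by rwa [hvS S]), smul_zero]
  simpa using hindep.fintype_card_le_finrank

theorem shadow_leadingSets_subset {X : Submodule F (V [⋀^Fin k]→ₗ[F] F)}
    {Y : Submodule F (V [⋀^Fin (k + 1)]→ₗ[F] F)} (hXY : ∀ y ∈ Y, ∀ a, y.curryLeft a ∈ X) :
    ∂ (leadingSets b Y) ⊆ leadingSets b X := by
  intro T hT
  obtain ⟨_, hS, a, ha, rfl⟩ := mem_shadow_iff.1 hT
  obtain ⟨y, hyY, v, rfl, hv, hlead⟩ := mem_leadingSets.1 hS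
  obtain ⟨i, -, rfl⟩ := mem_image.1 ha
  have hvinj := injective_of_map_basis_ne_zero hv
  have hcurry (u : Fin k → Fin n) : y.curryLeft (b (v i)) (b ∘ u) = y (b ∘ Fin.cons (v i) u) := by
    rw [AlternatingMap.curryLeft_apply_apply, Matrix.vecCons, ← Fin.comp_cons]
  have himage (u : Fin k → Fin n) :
      univ.image (Fin.cons (v i) u : Fin (k + 1) → Fin n) = insert (v i) (univ.image u) := by
    ext x
    simp [Fin.exists_fin_succ, eq_comm]
  have hremove : univ.image (v ∘ i.succAbove) = (univ.image v).erase (v i) := by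
    rw [← image_image, Fin.image_succAbove_univ, ← image_erase hvinj, compl_eq_univ_sdiff,
      sdiff_singleton_eq_erase]
  refine mem_leadingSets.2 ⟨y.curryLeft (b (v i)), hXY y hyY _, v ∘ i.succAbove, hremove, ?_, ?_⟩
  · rw [hcurry]
    refine map_basis_ne_zero_of_image_eq hv (Fin.cons_injective_iff.2 ⟨?_, ?_⟩) ?_
    · rintro ⟨j, hj⟩
      exact i.succAbove_ne j (hvinj hj)
    · exact hvinj.comp i.succAbove_right_injective
    · rw [himage, hremove, insert_erase ha]
  · intro u hu
    rw [hcurry]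
    by_contra hne
    have hnotMem : v i ∉ univ.image u := by
      simpa using (Fin.cons_injective_iff.1 (injective_of_map_basis_ne_zero hne)).1
    refine hne (hlead _ ?_)
    rw [himage, ← insert_erase ha]
    exact lt_of_not_ge fun h ↦
      hu.not_ge ((toColex_insert_le_toColex_insert hnotMem (notMem_erase _ _)).1 h)

theorem finrank_le_overlapBound_of_curryLeft_mem [FiniteDimensional F V]
    {X : Submodule F (V [⋀^Fin 2]→ₗ[F] F)} {Y : Submodule F (V [⋀^Fin 3]→ₗ[F] F)}
    (hXY : ∀ y ∈ Y, ∀ a, y.curryLeft a ∈ X) {e : ℕ} (he : finrank F X ≤ e) :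
    finrank F Y ≤ overlapBound e := by
  have b := finBasis F V
  calc finrank F Y ≤ #(leadingSets b Y) := finrank_le_card_leadingSets Y
    _ ≤ overlapBound e := card_le_overlapBound_of_card_shadow_le (sized_leadingSets Y)
        ((card_le_card (shadow_leadingSets_subset hXY)).trans
          ((card_leadingSets_le_finrank X).trans he))

end LeadingSets

section JacobiForms

variable {F V W U : Type*} [Field F] [AddCommGroup V] [Module F V] [AddCommGroup W] [Module F W]
  [AddCommGroup U] [Module F U]

/-- The span of the values of a bilinear map. -/
abbrev valueSpan (β : V →ₗ[F] V →ₗ[F] W) : Submodule F W := Submodule.map₂ β ⊤ ⊤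

/-- The Jacobi identity for a bilinear map `τ` out of `W × V`, where `τ` is read as the bracket
with the value of a bilinear map `β` on `V`. -/
def IsJacobiForm (β : V →ₗ[F] V →ₗ[F] W) (τ : W →ₗ[F] V →ₗ[F] U) : Prop :=
  ∀ a b c, τ (β a b) c + τ (β b c) a + τ (β c a) b = 0

/-- Some scalar-valued Jacobi form of `β` does not kill `w`. -/
def DetectedByJacobiForm (β : V →ₗ[F] V →ₗ[F] W) (w : W) : Prop :=
  ∃ τ : W →ₗ[F] V →ₗ[F] F, IsJacobiForm β τ ∧ τ w ≠ 0

theorem finrank_le_finrank_inf_ker_add [FiniteDimensional F V] {f : V →ₗ[F] W}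
    {S : Submodule F V} {T : Submodule F W} [FiniteDimensional F T] (hST : S ≤ T.comap f) :
    finrank F S ≤ finrank F (S ⊓ LinearMap.ker f : Submodule F V) + finrank F T := by
  have hker : (LinearMap.ker (f.restrict hST)).map S.subtype = S ⊓ LinearMap.ker f := by
    rw [LinearMap.ker_restrict, Submodule.map_comap_subtype]
  have hrank := (f.restrict hST).finrank_range_add_finrank_ker
  have hrange := (LinearMap.range (f.restrict hST)).finrank_le
  rw [← hker, Submodule.finrank_map_subtype_eq]
  omega

/-- The image of `v 0 ∧ ⋯ ∧ v (k - 1)` in the space of alternating forms on the dual of `V`. -/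
def wedge {k : ℕ} (v : Fin k → V) : Dual F V [⋀^Fin k]→ₗ[F] F :=
  Matrix.detRowAlternating.compLinearMap (LinearMap.pi fun i ↦ Dual.eval F V (v i))

theorem wedge_apply {k : ℕ} (v : Fin k → V) (φ : Fin k → Dual F V) :
    wedge v φ = Matrix.det (Matrix.of fun i j ↦ φ i (v j)) := rfl

theorem curryLeft_wedge_three (a b c : V) (φ : Dual F V) :
    (wedge ![a, b, c]).curryLeft φ =
      φ c • wedge ![a, b] + φ a • wedge ![b, c] + φ b • wedge ![c, a] := by
  ext ψ
  simp [wedge_apply, Matrix.det_fin_two, Matrix.det_fin_three]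
  ring

/-- The linear map that sends `wedge ![a, b]` to `β a b - β b a`. -/
noncomputable def wedgeLift [FiniteDimensional F V] (β : V →ₗ[F] V →ₗ[F] W) :
    (Dual F V [⋀^Fin 2]→ₗ[F] F) →ₗ[F] W :=
  let e := finBasis F V
  { toFun := fun ω ↦ ∑ i, ∑ j, ω ![e.coord i, e.coord j] • β (e i) (e j)
    map_add' := fun ω η ↦ by simp [add_smul, sum_add_distrib]
    map_smul' := fun r ω ↦ by simp [smul_sum, mul_smul] }

theorem wedgeLift_wedge [FiniteDimensional F V] (β : V →ₗ[F] V →ₗ[F] W) (a b : V) :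
    wedgeLift β (wedge ![a, b]) = β a b - β b a := by
  let e := finBasis F V
  have hexpand (a b : V) : β a b = ∑ i, ∑ j, (e.coord i a * e.coord j b) • β (e i) (e j) := by
    conv_lhs => rw [← e.sum_repr a, ← e.sum_repr b]
    simp only [map_sum, map_smul, LinearMap.sum_apply, LinearMap.smul_apply, smul_sum, mul_smul,
      Basis.coord_apply]
    rw [sum_comm]
    exact sum_congr rfl fun i _ ↦ sum_congr rfl fun j _ ↦ smul_comm ..
  rw [hexpand a b, hexpand b a]
  simp only [← sum_sub_distrib, ← sub_smul]
  simp [wedgeLift, wedge_apply, Matrix.det_fin_two, e, mul_comm]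

theorem valueSpan_le_range_wedgeLift [FiniteDimensional F V] (h2 : (2 : F) ≠ 0)
    {β : V →ₗ[F] V →ₗ[F] W} (hβ : β.IsAlt) : valueSpan β ≤ LinearMap.range (wedgeLift β) :=
  Submodule.map₂_le.2 fun a _ b _ ↦
    ⟨(2 : F)⁻¹ • wedge ![a, b], by
      rw [map_smul, wedgeLift_wedge, ← hβ.neg a b, sub_neg_eq_add, ← two_smul F, inv_smul_smul₀ h2]⟩

/-- The linear form `φ ↦ φ u • w` on the dual of `V`, bilinearly in `w` and `u`. -/
def evalSMul : W →ₗ[F] V →ₗ[F] Dual F V →ₗ[F] W :=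
  (LinearMap.smulRightₗ (R := F) (M₂ := Dual F V) (M := W)).flip.compl₂ (Dual.eval F V)

theorem evalSMul_apply (w : W) (u : V) (φ : Dual F V) : evalSMul w u φ = φ u • w := rfl

/-- Contraction of an alternating form of degree three, followed by `wedgeLift`. -/
noncomputable def contractLift [FiniteDimensional F V] (β : V →ₗ[F] V →ₗ[F] W) :
    (Dual F V [⋀^Fin 3]→ₗ[F] F) →ₗ[F] Dual F V →ₗ[F] W :=
  (wedgeLift β).compRight F ∘ₗ AlternatingMap.curryLeftLinearMap

theorem contractLift_apply [FiniteDimensional F V] (β : V →ₗ[F] V →ₗ[F] W)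
    (y : Dual F V [⋀^Fin 3]→ₗ[F] F) (φ : Dual F V) :
    contractLift β y φ = wedgeLift β (y.curryLeft φ) := rfl

theorem isJacobiForm_compr₂_evalSMul [FiniteDimensional F V] (h2 : (2 : F) ≠ 0)
    {β : V →ₗ[F] V →ₗ[F] W} (hβ : β.IsAlt) {Φ : (Dual F V →ₗ[F] W) →ₗ[F] U}
    (hΦ : LinearMap.range (contractLift β) ≤ LinearMap.ker Φ) :
    IsJacobiForm β (evalSMul.compr₂ Φ) := by
  intro a b c
  have hcontract : contractLift β (wedge ![a, b, c]) =
      (2 : F) • (evalSMul (β a b) c + evalSMul (β b c) a + evalSMul (β c a) b) := by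
    ext φ
    have htwice (a b : V) : β a b - β b a = (2 : F) • β a b := by
      rw [← hβ.neg a b, sub_neg_eq_add, two_smul]
    simp only [contractLift_apply, curryLeft_wedge_three, map_add, map_smul, wedgeLift_wedge,
      htwice, LinearMap.smul_apply, LinearMap.add_apply, evalSMul_apply, smul_add,
      smul_comm (2 : F)]
  have hzero := hΦ ⟨wedge ![a, b, c], hcontract⟩
  rw [LinearMap.mem_ker, map_smul] at hzero
  simpa only [map_add, LinearMap.compr₂_apply] using (smul_eq_zero.1 hzero).resolve_left h2

theorem finrank_le_overlapBound_of_not_detected [FiniteDimensional F V] (h2 : (2 : F) ≠ 0)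
    {β : V →ₗ[F] V →ₗ[F] W} (hβ : β.IsAlt) {w : W} (hw : w ≠ 0) (hdet : ¬ DetectedByJacobiForm β w)
    {e : ℕ} (he : finrank F ((F ∙ w).comap (wedgeLift β)) ≤ e) :
    finrank F V ≤ overlapBound e := by
  have hrange : LinearMap.range (evalSMul (F := F) (V := V) w) ≤
      LinearMap.range (contractLift β) := by
    rintro _ ⟨u, rfl⟩
    by_contra hu
    obtain ⟨Φ, hΦu, hΦ⟩ := Submodule.exists_le_ker_of_notMem hu
    exact hdet ⟨evalSMul.compr₂ Φ, isJacobiForm_compr₂_evalSMul h2 hβ hΦ,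
      fun h ↦ hΦu (LinearMap.congr_fun h u)⟩
  have hinj : Function.Injective (evalSMul (F := F) (V := V) w) := by
    rw [injective_iff_map_eq_zero]
    intro u hu
    refine (forall_dual_apply_eq_zero_iff F u).1 fun φ ↦ ?_
    simpa [evalSMul_apply, hw] using LinearMap.congr_fun hu φ
  set Y := (LinearMap.range (evalSMul (F := F) (V := V) w)).comap (contractLift β)
  calc finrank F V = finrank F (LinearMap.range (evalSMul (F := F) (V := V) w)) :=
        (LinearMap.finrank_range_of_inj hinj).symm
    _ = finrank F (Y.map (contractLift β)) := by rw [Submodule.map_comap_eq_of_le hrange]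
    _ ≤ finrank F Y := Submodule.finrank_map_le _ _
    _ ≤ overlapBound e := finrank_le_overlapBound_of_curryLeft_mem (fun y hy φ ↦ by
        obtain ⟨u, hu⟩ := hy
        exact Submodule.mem_span_singleton.2 ⟨φ u, LinearMap.congr_fun hu φ⟩) he

theorem detectedByJacobiForm_of_overlapBound_lt [FiniteDimensional F V] (h2 : (2 : F) ≠ 0)
    {β : V →ₗ[F] V →ₗ[F] W} (hβ : β.IsAlt)
    (hlt : overlapBound ((finrank F V).choose 2 - finrank F (valueSpan β) + 1) < finrank F V)
    {w : W} (hw : w ≠ 0) : DetectedByJacobiForm β w := by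
  by_contra hdet
  refine hlt.not_ge (finrank_le_overlapBound_of_not_detected h2 hβ hw hdet ?_)
  have hspan := Submodule.finrank_mono (valueSpan_le_range_wedgeLift h2 hβ)
  have hrank := (wedgeLift β).finrank_range_add_finrank_ker
  rw [finrank_alternatingMap, Subspace.dual_finrank_eq] at hrank
  have hcomap := finrank_le_finrank_inf_ker_add (le_refl ((F ∙ w).comap (wedgeLift β)))
  have hinf := Submodule.finrank_mono
    (inf_le_right : (F ∙ w).comap (wedgeLift β) ⊓ LinearMap.ker (wedgeLift β) ≤ _)
  rw [finrank_span_singleton hw] at hcomap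
  omega

end JacobiForms

section Necessity

variable {F V W : Type*} [Field F] [AddCommGroup V] [Module F V] [AddCommGroup W] [Module F W]

/-- The vectors whose bracket with every vector lies in `S`; for `S = ⊥` this is the right radical
of `β`. -/
def radicalMod (β : V →ₗ[F] V →ₗ[F] W) (S : Submodule F W) : Submodule F V := ⨅ a, S.comap (β a)

theorem mem_radicalMod {β : V →ₗ[F] V →ₗ[F] W} {S : Submodule F W} {c : V} :
    c ∈ radicalMod β S ↔ ∀ a, β a c ∈ S := by
  simp [radicalMod]

theorem radicalMod_eq_top {β : V →ₗ[F] V →ₗ[F] W} {S : Submodule F W} (hS : valueSpan β ≤ S) :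
    radicalMod β S = ⊤ :=
  eq_top_iff.2 fun _ _ ↦ mem_radicalMod.2 fun _ ↦ hS (Submodule.apply_mem_map₂ β trivial trivial)

theorem radicalMod_bot {β : V →ₗ[F] V →ₗ[F] W} (hβ : β.IsAlt) :
    radicalMod β ⊥ = LinearMap.ker β := by
  ext c
  rw [mem_radicalMod, LinearMap.mem_ker, LinearMap.ext_iff]
  exact forall_congr' fun a ↦ by rw [Submodule.mem_bot, ← hβ.neg, neg_eq_zero, LinearMap.zero_apply]

theorem finrank_add_le_finrank_inf_ker_flip_add [FiniteDimensional F V] [FiniteDimensional F W]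
    (τ : W →ₗ[F] V →ₗ[F] F) (R : Submodule F V) {S M : Submodule F W} (hSM : S ≤ M)
    (hS : S ≤ LinearMap.ker τ) :
    finrank F R + finrank F S ≤
      finrank F (R ⊓ LinearMap.ker (τ.domRestrict M).flip : Submodule F V) + finrank F M := by
  have hR : R ≤ (S.submoduleOf M).dualAnnihilator.comap (τ.domRestrict M).flip := by
    refine fun x _ ↦ (Submodule.mem_dualAnnihilator _).2 fun u hu ↦ ?_
    exact LinearMap.congr_fun (hS hu) x
  have hinf : finrank F R ≤
      finrank F (R ⊓ LinearMap.ker (τ.domRestrict M).flip : Submodule F V) +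
        finrank F (S.submoduleOf M).dualAnnihilator := finrank_le_finrank_inf_ker_add hR
  have hann := Subspace.finrank_add_finrank_dualAnnihilator_eq (S.submoduleOf M)
  rw [(Submodule.submoduleOfEquivOfLe hSM).finrank_eq] at hann
  omega

theorem exists_separating_vectors [FiniteDimensional F W] (τ : W →ₗ[F] V →ₗ[F] F)
    (S : Submodule F W) :
    ∃ (s : ℕ) (b : Fin s → V),
      s + finrank F (S ⊓ LinearMap.ker τ : Submodule F W) ≤ finrank F S ∧
      ∀ w ∈ S, (∀ i, τ w (b i) = 0) → τ w = 0 := by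
  let t := τ.domRestrict S
  let R : Submodule F (Dual F S) := LinearMap.range t.flip
  have : Module.Free F R := .of_divisionRing F R
  let e := finBasis F R
  choose b hb using fun i ↦ (e i).2
  have hR : R ≤ (LinearMap.ker t).dualAnnihilator := by
    rintro _ ⟨x, rfl⟩
    exact (Submodule.mem_dualAnnihilator _).2 fun w hw ↦ LinearMap.congr_fun hw x
  have hker : (LinearMap.ker t).map S.subtype = S ⊓ LinearMap.ker τ := by
    rw [LinearMap.ker_domRestrict, Submodule.map_comap_subtype]
  refine ⟨finrank F R, b, ?_, fun w hw hwb ↦ LinearMap.ext fun x ↦ ?_⟩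
  · have hann := Subspace.finrank_add_finrank_dualAnnihilator_eq (LinearMap.ker t)
    have hmono := Submodule.finrank_mono hR
    rw [← hker, Submodule.finrank_map_subtype_eq]
    omega
  · have heval : LinearMap.applyₗ (⟨w, hw⟩ : S) ∘ₗ R.subtype = 0 :=
      e.ext fun i ↦ (LinearMap.congr_fun (hb i) ⟨w, hw⟩).symm.trans (hwb i)
    exact LinearMap.congr_fun heval ⟨t.flip x, x, rfl⟩

theorem IsJacobiForm.apply_comm {β : V →ₗ[F] V →ₗ[F] W} (hβ : β.IsAlt) {τ : W →ₗ[F] V →ₗ[F] F}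
    (hτ : IsJacobiForm β τ) {c : V} (hc : ∀ u ∈ valueSpan β, τ u c = 0) (a a' : V) :
    τ (β a c) a' = τ (β a' c) a := by
  have hjacobi := hτ a c a'
  rw [hc _ (Submodule.apply_mem_map₂ β trivial trivial), add_zero, ← hβ.neg a' c, map_neg,
    LinearMap.neg_apply, ← sub_eq_add_neg] at hjacobi
  exact sub_eq_zero.1 hjacobi

theorem finrank_radicalMod_inf_le [FiniteDimensional F V] {β : V →ₗ[F] V →ₗ[F] W} (hβ : β.IsAlt)
    {τ : W →ₗ[F] V →ₗ[F] F} (hτ : IsJacobiForm β τ) {S : Submodule F W} {s : ℕ} {b : Fin s → V}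
    (hb : ∀ w ∈ S, (∀ i, τ w (b i) = 0) → τ w = 0) :
    finrank F (radicalMod β S ⊓ LinearMap.ker (τ.domRestrict (valueSpan β)).flip :
        Submodule F V) ≤
      finrank F (radicalMod β (S ⊓ LinearMap.ker τ)) + (s + 1).choose 2 := by
  -- For `c` in the left-hand side `(a, a') ↦ τ (β a c) a'` is symmetric, hence determined by its
  -- values on unordered pairs of separating vectors.
  let values : V →ₗ[F] Sym2 (Fin s) → F :=
    LinearMap.pi fun σ ↦ τ.flip (b σ.sup) ∘ₗ β (b σ.inf)
  have hcount := finrank_le_finrank_inf_ker_add (f := values) (T := ⊤)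
    (S := radicalMod β S ⊓ LinearMap.ker (τ.domRestrict (valueSpan β)).flip) fun _ _ ↦ trivial
  have hsym2 : finrank F (⊤ : Submodule F (Sym2 (Fin s) → F)) = (s + 1).choose 2 := by
    simp [Sym2.card]
  rw [hsym2] at hcount
  refine hcount.trans (Nat.add_le_add_right (Submodule.finrank_mono ?_) _)
  rintro c ⟨⟨hcS, hcτ⟩, hcb⟩
  rw [SetLike.mem_coe, mem_radicalMod] at hcS
  have hsymm := hτ.apply_comm hβ (c := c) fun u hu ↦ LinearMap.congr_fun hcτ ⟨u, hu⟩
  have hle {i j} (hij : i ≤ j) : τ (β (b i) c) (b j) = 0 := by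
    simpa [values, hij, hsymm] using congrFun hcb s(i, j)
  have hpair (i j) : τ (β (b i) c) (b j) = 0 :=
    (le_total i j).elim hle fun hji ↦ (hsymm _ _).trans (hle hji)
  have hvector (i) : τ (β (b i) c) = 0 := hb _ (hcS _) (hpair i)
  refine mem_radicalMod.2 fun a ↦ ⟨hcS a, hb _ (hcS a) fun i ↦ ?_⟩
  rw [hsymm, hvector, LinearMap.zero_apply]

theorem choose_two_add_add_one (k r : ℕ) :
    (k + r + 1).choose 2 = (k + 1).choose 2 + (r + 1).choose 2 + k * r := by
  induction r with
  | zero => simp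
  | succ r ih =>
    rw [← add_assoc, Nat.choose_succ_succ' (k + r + 1) 1, Nat.choose_succ_succ' (r + 1) 1]
    simp only [Nat.choose_one_right, ih, Nat.reduceAdd]
    ring

theorem finrank_radicalMod_add_le [FiniteDimensional F V] [FiniteDimensional F W]
    {β : V →ₗ[F] V →ₗ[F] W} (hβ : β.IsAlt) {m : ℕ} (hm : finrank F (valueSpan β) = m)
    (hdet : ∀ w ∈ valueSpan β, w ≠ 0 → DetectedByJacobiForm β w)
    (S : Submodule F W) (hS : S ≤ valueSpan β) {k : ℕ} (hk : finrank F S + k = m) :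
    finrank F (radicalMod β S) + (k + (k + 1).choose 2) ≤
      finrank F (LinearMap.ker β) + (m + (m + 1).choose 2) := by
  induction S using WellFoundedLT.induction generalizing k with
  | _ S ih =>
    rcases eq_or_ne S ⊥ with rfl | hne
    · rw [finrank_bot, zero_add] at hk
      rw [radicalMod_bot hβ, hk]
    obtain ⟨w, hw, hw0⟩ := Submodule.exists_mem_ne_zero_of_ne_bot hne
    obtain ⟨τ, hτ, hτw⟩ := hdet w (hS hw) hw0
    obtain ⟨s, b, hs, hb⟩ := exists_separating_vectors τ S
    have hlt : S ⊓ LinearMap.ker τ < S := inf_lt_left.2 fun h ↦ hτw (h hw)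
    obtain ⟨r, hr⟩ := Nat.exists_eq_add_of_lt (Submodule.finrank_lt_finrank_of_lt hlt)
    have hih := ih _ hlt (inf_le_left.trans hS) (k := k + (r + 1)) (by omega)
    have hflip := finrank_add_le_finrank_inf_ker_flip_add τ (radicalMod β S)
      (inf_le_left.trans hS) (inf_le_right : S ⊓ LinearMap.ker τ ≤ _)
    have hsymm := finrank_radicalMod_inf_le hβ hτ hb
    have hmono : (s + 1).choose 2 ≤ (r + 1 + 1).choose 2 := Nat.choose_le_choose 2 (by omega)
    have hsplit := choose_two_add_add_one k (r + 1)
    rw [mul_add_one] at hsplit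
    omega

theorem finrank_le_of_detectedByJacobiForm [FiniteDimensional F V] [FiniteDimensional F W]
    {β : V →ₗ[F] V →ₗ[F] W} (hβ : β.IsAlt)
    (hdet : ∀ w ∈ valueSpan β, w ≠ 0 → DetectedByJacobiForm β w) :
    finrank F V ≤ finrank F (LinearMap.ker β) +
      (2 * finrank F (valueSpan β) + (finrank F (valueSpan β)).choose 2) := by
  have h := finrank_radicalMod_add_le hβ rfl hdet _ le_rfl (k := 0) rfl
  rw [radicalMod_eq_top le_rfl, finrank_top] at h
  refine h.trans_eq (congrArg _ ?_)
  rw [Nat.choose_succ_succ', Nat.choose_one_right, ← add_assoc, ← two_mul]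

end Necessity

section Coboundaries

variable {F V W : Type*} [Field F] [AddCommGroup V]

/-- The coboundary of an inhomogeneous `2`-cochain of the additive group `V` with trivial
coefficients. -/
def coboundary : (V → V → F) →ₗ[F] V → V → V → F where
  toFun γ x y z := γ y z - γ (x + y) z + γ x (y + z) - γ x y
  map_add' γ γ' := by ext; simp only [Pi.add_apply]; ring
  map_smul' r γ := by ext; simp only [Pi.smul_apply, smul_eq_mul, RingHom.id_apply]; ring

theorem coboundary_apply (γ : V → V → F) (x y z : V) :
    coboundary γ x y z = γ y z - γ (x + y) z + γ x (y + z) - γ x y := rfl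

variable [Module F V] [AddCommGroup W] [Module F W]

/-- The trilinear form `f ⊗ g ⊗ h`, as a function. -/
def tensorForm (f g h : Dual F V) : V → V → V → F := fun x y z ↦ f x * g y * h z

theorem tensorForm_add_swap_left_mem (f g h : Dual F V) :
    tensorForm f g h + tensorForm g f h ∈ LinearMap.range (coboundary (F := F) (V := V)) :=
  ⟨fun x y ↦ -(f x * g x * h y), by
    ext
    simp only [coboundary_apply, tensorForm, Pi.add_apply, map_add]
    ring⟩

theorem tensorForm_add_swap_right_mem (f g h : Dual F V) :
    tensorForm f g h + tensorForm f h g ∈ LinearMap.range (coboundary (F := F) (V := V)) :=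
  ⟨fun x y ↦ f x * g y * h y, by
    ext
    simp only [coboundary_apply, tensorForm, Pi.add_apply, map_add]
    ring⟩

/-- The class of `f ⊗ g ⊗ h` modulo coboundaries. -/
def tensorClass (t : Dual F V × Dual F V × Dual F V) :
    (V → V → V → F) ⧸ LinearMap.range (coboundary (F := F) (V := V)) :=
  Submodule.Quotient.mk (tensorForm t.1 t.2.1 t.2.2)

theorem tensorClass_swap_left (f g h : Dual F V) :
    tensorClass (g, f, h) = -tensorClass (f, g, h) := by
  rw [eq_neg_iff_add_eq_zero]
  exact (Submodule.Quotient.mk_eq_zero _).2 (tensorForm_add_swap_left_mem g f h)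

theorem tensorClass_swap_right (f g h : Dual F V) :
    tensorClass (f, h, g) = -tensorClass (f, g, h) := by
  rw [eq_neg_iff_add_eq_zero]
  exact (Submodule.Quotient.mk_eq_zero _).2 (tensorForm_add_swap_right_mem f h g)

theorem tensorClass_rotate (f g h : Dual F V) : tensorClass (g, h, f) = tensorClass (f, g, h) := by
  rw [tensorClass_swap_right, tensorClass_swap_left, neg_neg]

theorem tensorClass_self_left (h2 : (2 : F) ≠ 0) (f g : Dual F V) : tensorClass (f, f, g) = 0 := by
  have htwo : (2 : F) • tensorClass (f, f, g) = 0 := by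
    rw [two_smul]
    exact eq_neg_iff_add_eq_zero.1 (tensorClass_swap_left f f g)
  exact (smul_eq_zero.1 htwo).resolve_left h2

/-- The cyclic rotation of triples. -/
def rotateTriple (I : Type*) : Equiv.Perm (I × I × I) where
  toFun t := (t.2.1, t.2.2, t.1)
  invFun t := (t.2.2, t.1, t.2.1)

theorem sum_eq_zero_of_cyclic {I M : Type*} [Fintype I] [LinearOrder I] [AddCommGroup M]
    (a : I × I × I → M)
    (hcyclic : ∀ i j k, a (i, j, k) + a (j, k, i) + a (k, i, j) = 0)
    (hleft : ∀ i j, a (i, i, j) = 0) (hright : ∀ i j, a (j, i, i) = 0)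
    (houter : ∀ i j, a (i, j, i) = 0) :
    ∑ t, a t = 0 := by
  -- Among the three rotations of a triple of distinct indices exactly one ends with the largest.
  let ρ := rotateTriple I
  let d (t u : I × I × I) : M := if t.1 < t.2.2 ∧ t.2.1 < t.2.2 then a u else 0
  have hsplit (t) : a t = d t t + d (ρ t) t + d (ρ (ρ t)) t := by
    obtain ⟨i, j, k⟩ := t
    change a (i, j, k) = (if i < k ∧ j < k then a (i, j, k) else 0) +
      (if j < i ∧ k < i then a (i, j, k) else 0) + (if k < j ∧ i < j then a (i, j, k) else 0)
    rcases eq_or_ne i j with rfl | hij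
    · simp [hleft]
    rcases eq_or_ne j k with rfl | hjk
    · simp [hright]
    rcases eq_or_ne i k with rfl | hik
    · simp [houter]
    grind
  have hone : ∑ t, d (ρ t) t = ∑ t, d t (ρ (ρ t)) := by
    rw [← Equiv.sum_comp ρ fun t ↦ d t (ρ (ρ t))]
    rfl
  have htwo : ∑ t, d (ρ (ρ t)) t = ∑ t, d t (ρ t) := by
    rw [← Equiv.sum_comp (ρ.trans ρ) fun t ↦ d t (ρ t)]
    rfl
  rw [sum_congr rfl fun t _ ↦ hsplit t, sum_add_distrib, sum_add_distrib, hone, htwo,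
    ← sum_add_distrib, ← sum_add_distrib]
  refine sum_eq_zero fun t _ ↦ ?_
  obtain ⟨i, j, k⟩ := t
  simp only [d]
  split_ifs
  · exact (add_right_comm _ _ _).trans (hcyclic i j k)
  · simp

theorem sum_smul_tensorClass_eq_zero {I : Type*} [Fintype I] [LinearOrder I] (h2 : (2 : F) ≠ 0)
    (f : I → Dual F V) (c : I × I × I → F)
    (hc : ∀ i j k, c (i, j, k) + c (j, k, i) + c (k, i, j) = 0) :
    ∑ t, c t • tensorClass (f t.1, f t.2.1, f t.2.2) = 0 := by
  refine sum_eq_zero_of_cyclic _ (fun i j k ↦ ?_) (fun i j ↦ ?_) (fun i j ↦ ?_) fun i j ↦ ?_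
  · rw [tensorClass_rotate (f i), ← tensorClass_rotate (f k), ← add_smul, ← add_smul, hc, zero_smul]
  · rw [tensorClass_self_left h2, smul_zero]
  · rw [← tensorClass_rotate, tensorClass_self_left h2, smul_zero]
  · rw [tensorClass_rotate (f i), tensorClass_self_left h2, smul_zero]

theorem IsJacobiForm.mem_range_coboundary [FiniteDimensional F V] (h2 : (2 : F) ≠ 0)
    {β : V →ₗ[F] V →ₗ[F] W} {τ : W →ₗ[F] V →ₗ[F] F} (hτ : IsJacobiForm β τ) :
    (fun x y z ↦ τ (β x y) z) ∈ LinearMap.range (coboundary (F := F) (V := V)) := by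
  let e := finBasis F V
  have hexpand : (fun x y z ↦ τ (β x y) z) =
      ∑ t : Fin (finrank F V) × Fin (finrank F V) × Fin (finrank F V),
        τ (β (e t.1) (e t.2.1)) (e t.2.2) •
          tensorForm (e.coord t.1) (e.coord t.2.1) (e.coord t.2.2) := by
    ext x y z
    simp only [Fintype.sum_prod_type, Finset.sum_apply, Pi.smul_apply, tensorForm,
      Basis.coord_apply, smul_eq_mul]
    conv_lhs => rw [← e.sum_repr x]
    simp only [map_sum, map_smul, LinearMap.sum_apply, LinearMap.smul_apply, smul_eq_mul]
    refine sum_congr rfl fun i _ ↦ ?_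
    conv_lhs => rw [← e.sum_repr y]
    simp only [map_sum, map_smul, LinearMap.sum_apply, LinearMap.smul_apply, smul_eq_mul, mul_sum]
    refine sum_congr rfl fun j _ ↦ ?_
    conv_lhs => rw [← e.sum_repr z]
    simp only [map_sum, map_smul, smul_eq_mul, mul_sum]
    exact sum_congr rfl fun k _ ↦ by ring
  rw [← Submodule.Quotient.mk_eq_zero, hexpand, ← Submodule.mkQ_apply, map_sum]
  simp only [map_smul]
  exact sum_smul_tensorClass_eq_zero h2 e.coord
    (fun t ↦ τ (β (e t.1) (e t.2.1)) (e t.2.2)) fun _ _ _ ↦ hτ _ _ _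

end Coboundaries

/-- A `2`-cocycle of the group `G` with coefficients in the trivial `G`-module `A`. -/
structure TwoCocycle (G A : Type*) [Group G] [AddCommGroup A] where
  toFun : G → G → A
  cocycle (x y z : G) : toFun x y + toFun (x * y) z = toFun y z + toFun x (y * z)

namespace TwoCocycle

variable {G A : Type*} [Group G] [AddCommGroup A] (c : TwoCocycle G A)

theorem one_left (x : G) : c.toFun 1 x = c.toFun 1 1 := by
  simpa using (c.cocycle 1 1 x).symm

theorem one_right (x : G) : c.toFun x 1 = c.toFun 1 1 := by
  simpa using c.cocycle x 1 1

/-- A family of cocycles, as a cocycle with coefficients in the product. -/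
def pi {I : Type*} {B : I → Type*} [∀ i, AddCommGroup (B i)] (d : ∀ i, TwoCocycle G (B i)) :
    TwoCocycle G (∀ i, B i) where
  toFun x y i := (d i).toFun x y
  cocycle x y z := funext fun i ↦ (d i).cocycle x y z

instance : Zero (TwoCocycle G A) := ⟨⟨0, by simp⟩⟩

/-- The central extension of `G` by `A` with cocycle `c`. -/
@[ext] structure Extension (c : TwoCocycle G A) where
  base : G
  fiber : A

namespace Extension

instance : Mul c.Extension :=
  ⟨fun x y ↦ ⟨x.base * y.base, x.fiber + y.fiber + c.toFun x.base y.base⟩⟩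

-- `c` need not be normalized, so the identity and the inverse involve `c 1 1`.
instance : One c.Extension := ⟨⟨1, -c.toFun 1 1⟩⟩

instance : Inv c.Extension :=
  ⟨fun x ↦ ⟨x.base⁻¹, -x.fiber - c.toFun x.base⁻¹ x.base - c.toFun 1 1⟩⟩

variable {c}

@[simp] theorem mul_base (x y : c.Extension) : (x * y).base = x.base * y.base := rfl

@[simp] theorem mul_fiber (x y : c.Extension) :
    (x * y).fiber = x.fiber + y.fiber + c.toFun x.base y.base := rfl

@[simp] theorem one_base : (1 : c.Extension).base = 1 := rfl

@[simp] theorem one_fiber : (1 : c.Extension).fiber = -c.toFun 1 1 := rfl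

@[simp] theorem inv_base (x : c.Extension) : x⁻¹.base = x.base⁻¹ := rfl

@[simp] theorem inv_fiber (x : c.Extension) :
    x⁻¹.fiber = -x.fiber - c.toFun x.base⁻¹ x.base - c.toFun 1 1 := rfl

instance : Group c.Extension := Group.ofLeftAxioms
  (fun x y z ↦ Extension.ext (by simp [mul_assoc]) (by
    have h := c.cocycle x.base y.base z.base
    simp only [mul_fiber, mul_base]
    grind))
  (fun x ↦ Extension.ext (by simp) (by simp [c.one_left]))
  (fun x ↦ Extension.ext (by simp) (by simp only [mul_fiber, inv_fiber, inv_base, one_fiber]; abel))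

/-- The projection of the extension onto `G`. -/
def proj (c : TwoCocycle G A) : c.Extension →* G where
  toFun := base
  map_one' := rfl
  map_mul' _ _ := rfl

theorem proj_surjective (c : TwoCocycle G A) : Function.Surjective (proj c) := fun g ↦ ⟨⟨g, 0⟩, rfl⟩

theorem ker_proj_eq_center
    (hc : ∀ z ∈ Subgroup.center G, z ≠ 1 → ∃ x, c.toFun z x ≠ c.toFun x z) :
    (proj c).ker = Subgroup.center c.Extension := by
  ext x
  rw [MonoidHom.mem_ker, Subgroup.mem_center_iff]
  refine ⟨fun (hx : x.base = 1) y ↦ ?_, fun hx ↦ by_contra fun hne ↦ ?_⟩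
  · ext1
    · simp [hx]
    · simp [hx, c.one_left, c.one_right, add_comm]
  · have hcenter : x.base ∈ Subgroup.center G :=
      Subgroup.mem_center_iff.2 fun g ↦ congrArg base (hx ⟨g, 0⟩)
    obtain ⟨g, hg⟩ := hc x.base hcenter hne
    have hfiber := congrArg fiber (hx ⟨g, 0⟩)
    simp only [mul_fiber, zero_add, add_zero, add_right_inj] at hfiber
    exact hg hfiber.symm

end Extension

end TwoCocycle

theorem isCapable_of_surjective.{u} {G K : Type u} [Group G] [Group K] {q : K →* G}
    (hq : Function.Surjective q) (hker : q.ker = Subgroup.center K) : IsCapable G :=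
  ⟨K, inferInstance, ⟨(QuotientGroup.quotientKerEquivOfSurjective q hq).symm.trans
    (QuotientGroup.quotientMulEquivOfEq hker)⟩⟩

theorem IsCapable.exists_surjective.{u} {G : Type u} [Group G] (hG : IsCapable G) :
    ∃ (K : Type u) (_ : Group K) (q : K →* G),
      Function.Surjective q ∧ q.ker = Subgroup.center K := by
  obtain ⟨K, _, ⟨f⟩⟩ := hG
  refine ⟨K, inferInstance, f.symm.toMonoidHom.comp (QuotientGroup.mk' _),
    f.symm.surjective.comp (QuotientGroup.mk'_surjective _), ?_⟩
  ext k
  simp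

theorem IsCapable.of_mulEquiv.{u} {G H : Type u} [Group G] [Group H] (hG : IsCapable G)
    (f : G ≃* H) : IsCapable H := by
  obtain ⟨K, _, ⟨e⟩⟩ := hG
  exact ⟨K, inferInstance, ⟨f.symm.trans e⟩⟩

theorem isCapable_of_forall_exists_twoCocycle.{u, v} {G : Type (max u v)} {A : Type v}
    [Group G] [AddCommGroup A]
    (h : ∀ z ∈ Subgroup.center G, z ≠ 1 →
      ∃ c : TwoCocycle G A, ∃ x, c.toFun z x ≠ c.toFun x z) : IsCapable G := by
  have hchoice (z : G) : ∃ c : TwoCocycle G A,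
      z ∈ Subgroup.center G → z ≠ 1 → ∃ x, c.toFun z x ≠ c.toFun x z := by
    by_cases hz : z ∈ Subgroup.center G ∧ z ≠ 1
    · exact (h z hz.1 hz.2).imp fun c hc _ _ ↦ hc
    · exact ⟨0, fun hcenter hne ↦ absurd ⟨hcenter, hne⟩ hz⟩
  choose d hd using hchoice
  refine isCapable_of_surjective (TwoCocycle.Extension.proj_surjective (.pi d))
    (TwoCocycle.Extension.ker_proj_eq_center fun z hz hz1 ↦ ?_)
  exact (hd z hz hz1).imp fun x hx heq ↦ hx (congrFun heq z)

section Heisenberg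

open scoped commutatorElement

variable {F V W : Type*} [Field F] [AddCommGroup V] [Module F V] [AddCommGroup W] [Module F W]

/-- The group on `V × W` with multiplication `(v, w) (v', w') = (v + v', w + w' + β v v' / 2)`. The
half makes `β` the commutator map when `β` is alternating. -/
@[ext] structure HeisenbergGroup (β : V →ₗ[F] V →ₗ[F] W) where
  base : V
  fiber : W

namespace HeisenbergGroup

variable {β : V →ₗ[F] V →ₗ[F] W}

instance : Mul (HeisenbergGroup β) :=
  ⟨fun x y ↦ ⟨x.base + y.base, x.fiber + y.fiber + (2 : F)⁻¹ • β x.base y.base⟩⟩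

instance : One (HeisenbergGroup β) := ⟨⟨0, 0⟩⟩

instance : Inv (HeisenbergGroup β) :=
  ⟨fun x ↦ ⟨-x.base, -x.fiber + (2 : F)⁻¹ • β x.base x.base⟩⟩

@[simp] theorem mul_base (x y : HeisenbergGroup β) : (x * y).base = x.base + y.base := rfl

@[simp] theorem mul_fiber (x y : HeisenbergGroup β) :
    (x * y).fiber = x.fiber + y.fiber + (2 : F)⁻¹ • β x.base y.base := rfl

@[simp] theorem one_base : (1 : HeisenbergGroup β).base = 0 := rfl

@[simp] theorem one_fiber : (1 : HeisenbergGroup β).fiber = 0 := rfl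

@[simp] theorem inv_base (x : HeisenbergGroup β) : x⁻¹.base = -x.base := rfl

@[simp] theorem inv_fiber (x : HeisenbergGroup β) :
    x⁻¹.fiber = -x.fiber + (2 : F)⁻¹ • β x.base x.base := rfl

instance : Group (HeisenbergGroup β) := Group.ofLeftAxioms
  (fun x y z ↦ HeisenbergGroup.ext (by simp [add_assoc]) (by
    simp only [mul_fiber, mul_base, map_add, LinearMap.add_apply, smul_add]
    abel))
  (fun x ↦ HeisenbergGroup.ext (by simp) (by simp))
  (fun x ↦ HeisenbergGroup.ext (by simp) (by simp))

/-- The projection onto the base. -/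
def proj (β : V →ₗ[F] V →ₗ[F] W) : HeisenbergGroup β →* Multiplicative V where
  toFun x := .ofAdd x.base
  map_one' := rfl
  map_mul' _ _ := rfl

theorem proj_surjective (β : V →ₗ[F] V →ₗ[F] W) : Function.Surjective (proj β) :=
  fun v ↦ ⟨⟨v.toAdd, 0⟩, rfl⟩

/-- The inclusion of the fiber. -/
def incl (β : V →ₗ[F] V →ₗ[F] W) : Multiplicative W →* HeisenbergGroup β where
  toFun w := ⟨0, w.toAdd⟩
  map_one' := rfl
  map_mul' _ _ := HeisenbergGroup.ext (by simp) (by simp)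

theorem incl_injective (β : V →ₗ[F] V →ₗ[F] W) : Function.Injective (incl β) :=
  fun _ _ h ↦ congrArg fiber h

/-- The inclusion of the fiber into the center. -/
def inclCenter (β : V →ₗ[F] V →ₗ[F] W) :
    Multiplicative W →* Subgroup.center (HeisenbergGroup β) :=
  (incl β).codRestrict _ fun _ ↦ Subgroup.mem_center_iff.2 fun _ ↦
    HeisenbergGroup.ext (by simp [incl]) (by simp [incl, add_comm])

theorem commutatorElement_eq (h2 : (2 : F) ≠ 0) (hβ : β.IsAlt) (x y : HeisenbergGroup β) :
    ⁅x, y⁆ = incl β (.ofAdd (β x.base y.base)) := by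
  rw [commutatorElement_def, mul_inv_eq_iff_eq_mul, mul_inv_eq_iff_eq_mul]
  ext
  · simp [incl, add_comm]
  · have hneg : β y.base x.base = -β x.base y.base := (hβ.neg _ _).symm
    have hhalf (u : W) : u = (2 : F)⁻¹ • u + (2 : F)⁻¹ • u := by
      rw [← two_smul F, smul_inv_smul₀ h2]
    simp only [incl, MonoidHom.coe_mk, OneHom.coe_mk, mul_fiber, mul_base, toAdd_ofAdd, map_zero,
      LinearMap.zero_apply, hneg, smul_neg, zero_add, smul_zero, add_zero]
    nth_rewrite 2 [hhalf (β x.base y.base)]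
    abel

theorem mem_center_iff (h2 : (2 : F) ≠ 0) (hβ : β.IsAlt) (hker : LinearMap.ker β = ⊥)
    {x : HeisenbergGroup β} : x ∈ Subgroup.center (HeisenbergGroup β) ↔ x.base = 0 := by
  have hcomm (y : HeisenbergGroup β) : y * x = x * y ↔ β x.base y.base = 0 := by
    rw [eq_comm, ← commutatorElement_eq_one_iff_mul_comm, commutatorElement_eq h2 hβ,
      map_eq_one_iff _ (incl_injective β), ofAdd_eq_one]
  simp only [Subgroup.mem_center_iff, hcomm]
  exact ⟨fun h ↦ LinearMap.ker_eq_bot'.1 hker _ (LinearMap.ext fun v ↦ h ⟨v, 0⟩),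
    fun h y ↦ by rw [h, map_zero, LinearMap.zero_apply]⟩

theorem ker_proj (h2 : (2 : F) ≠ 0) (hβ : β.IsAlt) (hker : LinearMap.ker β = ⊥) :
    (proj β).ker = Subgroup.center (HeisenbergGroup β) := by
  ext x
  rw [mem_center_iff h2 hβ hker]
  rfl

/-- The quotient of a Heisenberg group by its center. -/
noncomputable def quotientCenterEquiv (h2 : (2 : F) ≠ 0) (hβ : β.IsAlt)
    (hker : LinearMap.ker β = ⊥) :
    HeisenbergGroup β ⧸ Subgroup.center (HeisenbergGroup β) ≃* Multiplicative V :=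
  (QuotientGroup.quotientMulEquivOfEq (ker_proj h2 hβ hker).symm).trans
    (QuotientGroup.quotientKerEquivOfSurjective _ (proj_surjective β))

end HeisenbergGroup

end Heisenberg

section PrimeField

open scoped commutatorElement

variable {p : ℕ} [Fact p.Prime] {V W : Type*} [AddCommGroup V] [Module (ZMod p) V]
  [AddCommGroup W] [Module (ZMod p) W]

theorem toZModSubmodule_closure (S : Set V) :
    AddSubgroup.toZModSubmodule p (AddSubgroup.closure S) = Submodule.span (ZMod p) S :=
  le_antisymm
    ((AddSubgroup.closure_le (Submodule.span (ZMod p) S).toAddSubgroup).2 Submodule.subset_span)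
    (Submodule.span_le.2 AddSubgroup.subset_closure)

theorem closure_eq_top_iff_span_preimage_eq_top {S : Set (Multiplicative V)} :
    Subgroup.closure S = ⊤ ↔ Submodule.span (ZMod p) (Multiplicative.ofAdd ⁻¹' S) = ⊤ := by
  rw [← Subgroup.toAddSubgroup'.injective.eq_iff, Subgroup.toAddSubgroup'_closure, map_top,
    ← (AddSubgroup.toZModSubmodule p).injective.eq_iff, toZModSubmodule_closure, map_top]

theorem rank_multiplicative_eq_finrank [Finite V] :
    Group.rank (Multiplicative V) = finrank (ZMod p) V := by
  classical
  refine le_antisymm ?_ ?_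
  · let b := finBasis (ZMod p) V
    let S : Finset (Multiplicative V) := Finset.univ.image fun i ↦ .ofAdd (b i)
    have hS : Multiplicative.ofAdd ⁻¹' (S : Set (Multiplicative V)) = Set.range b := by
      ext v
      simp [S]
    refine (Group.rank_le (S := S) ?_).trans (Finset.card_image_le.trans (by simp))
    rw [closure_eq_top_iff_span_preimage_eq_top (p := p), hS, b.span_eq]
  · obtain ⟨S, hcard, hS⟩ := Group.rank_spec (Multiplicative V)
    have hspan := (closure_eq_top_iff_span_preimage_eq_top (p := p)).1 hS
    rw [← hcard, ← finrank_top, ← hspan]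
    exact finrank_span_finset_le_card (M := V) S

theorem HeisenbergGroup.commutator_eq (h2 : (2 : ZMod p) ≠ 0)
    {β : V →ₗ[ZMod p] V →ₗ[ZMod p] W} (hβ : β.IsAlt) :
    commutator (HeisenbergGroup β) =
      (AddSubgroup.toSubgroup (valueSpan β).toAddSubgroup).map (HeisenbergGroup.incl β) := by
  refine le_antisymm ?_ ?_
  · rw [commutator_def, Subgroup.commutator_le]
    intro x _ y _
    rw [commutatorElement_eq h2 hβ]
    exact Subgroup.mem_map_of_mem _ (Submodule.apply_mem_map₂ β trivial trivial)
  · rw [Subgroup.map_le_iff_le_comap]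
    have hle : valueSpan β ≤ AddSubgroup.toZModSubmodule p (Subgroup.toAddSubgroup'
        ((commutator (HeisenbergGroup β)).comap (HeisenbergGroup.incl β))) := by
      refine Submodule.map₂_le.2 fun v _ v' _ ↦ ?_
      have h := Subgroup.commutator_mem_commutator (Subgroup.mem_top (⟨v, 0⟩ : HeisenbergGroup β))
        (Subgroup.mem_top ⟨v', 0⟩)
      rw [commutatorElement_eq h2 hβ] at h
      exact h
    exact fun w hw ↦ hle hw

theorem HeisenbergGroup.rank_commutator [Finite W] (h2 : (2 : ZMod p) ≠ 0)
    {β : V →ₗ[ZMod p] V →ₗ[ZMod p] W} (hβ : β.IsAlt) [Group.FG (commutator (HeisenbergGroup β))] :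
    Group.rank (commutator (HeisenbergGroup β)) = finrank (ZMod p) (valueSpan β) := by
  rw [← rank_multiplicative_eq_finrank]
  exact Group.rank_congr ((MulEquiv.subgroupCongr (commutator_eq h2 hβ)).trans
    (Subgroup.equivMapOfInjective _ _ (incl_injective β)).symm)

end PrimeField

section Baer

open scoped commutatorElement

variable {G : Type*} [Group G]

theorem commutatorElement_mul_left_of_mem_center {a b c : G} (h : ⁅b, c⁆ ∈ Subgroup.center G) :
    ⁅a * b, c⁆ = ⁅a, c⁆ * ⁅b, c⁆ := by
  rw [commutatorElement_mul_left_eq_conj_mul, Subgroup.mem_center_iff.1 h, mul_inv_cancel_right,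
    Subgroup.mem_center_iff.1 h]

theorem commutatorElement_mul_right_of_mem_center {a b c : G} (h : ⁅a, c⁆ ∈ Subgroup.center G) :
    ⁅a, b * c⁆ = ⁅a, b⁆ * ⁅a, c⁆ := by
  rw [commutatorElement_mul_right_eq_mul_conj, mul_assoc ⁅a, b⁆, Subgroup.mem_center_iff.1 h,
    mul_assoc, mul_inv_cancel_right]

theorem commutatorElement_eq_one_of_mem_center_left {a b : G} (h : a ∈ Subgroup.center G) :
    ⁅a, b⁆ = 1 :=
  commutatorElement_eq_one_iff_mul_comm.2 (Subgroup.mem_center_iff.1 h b).symm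

theorem commutatorElement_eq_one_of_mem_center_right {a b : G} (h : b ∈ Subgroup.center G) :
    ⁅a, b⁆ = 1 :=
  commutatorElement_eq_one_iff_mul_comm.2 (Subgroup.mem_center_iff.1 h a)

theorem commutatorElement_mem_center (hclass : commutator G ≤ Subgroup.center G) (x y : G) :
    ⁅x, y⁆ ∈ Subgroup.center G :=
  hclass (Subgroup.commutator_mem_commutator (Subgroup.mem_top x) (Subgroup.mem_top y))

/-- Baer's sum on a group of class two and exponent dividing `2 * k + 1`. The exponent `k + 1`
stands for one half, so this is `x y [x, y]^(-1/2)`. -/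
def baerSum (k : ℕ) (x y : G) : G := x * y * ⁅y, x⁆ ^ (k + 1)

theorem baerSum_comm {k : ℕ} (hexp : ∀ g : G, g ^ (2 * k + 1) = 1)
    (hclass : commutator G ≤ Subgroup.center G) (x y : G) : baerSum k x y = baerSum k y x := by
  have hswap : y * x = x * y * ⁅y, x⁆ := by
    rw [Subgroup.mem_center_iff.1 (commutatorElement_mem_center hclass y x), commutatorElement_def]
    group
  have hpow : ⁅x, y⁆ ^ (k + 1) = ⁅y, x⁆ ^ k := by
    rw [← commutatorElement_inv, inv_pow, inv_eq_iff_mul_eq_one, ← pow_add, ← hexp ⁅y, x⁆]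
    congr 1
    omega
  rw [baerSum, baerSum, hswap, hpow, pow_succ', mul_assoc (x * y)]

theorem commutatorElement_baerSum_left (hclass : commutator G ≤ Subgroup.center G) (k : ℕ)
    (x y z : G) : ⁅baerSum k x y, z⁆ = ⁅x, z⁆ * ⁅y, z⁆ := by
  have hcomm := commutatorElement_mem_center hclass
  have hpow : ⁅⁅y, x⁆ ^ (k + 1), z⁆ = 1 :=
    commutatorElement_eq_one_of_mem_center_left (pow_mem (hcomm y x) _)
  rw [baerSum, commutatorElement_mul_left_of_mem_center (hcomm _ _), hpow, mul_one,
    commutatorElement_mul_left_of_mem_center (hcomm _ _)]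

theorem commutatorElement_baerSum_right (hclass : commutator G ≤ Subgroup.center G) (k : ℕ)
    (x y z : G) : ⁅x, baerSum k y z⁆ = ⁅x, y⁆ * ⁅x, z⁆ := by
  have hcenter := commutatorElement_mem_center hclass
  rw [← commutatorElement_inv, commutatorElement_baerSum_left hclass, mul_inv_rev,
    commutatorElement_inv, commutatorElement_inv, Subgroup.mem_center_iff.1 (hcenter x y)]

theorem baerSum_assoc (hclass : commutator G ≤ Subgroup.center G) (k : ℕ) (x y z : G) :
    baerSum k (baerSum k x y) z = baerSum k x (baerSum k y z) := by
  have hpow (x y : G) : ⁅x, y⁆ ^ (k + 1) ∈ Subgroup.center G :=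
    pow_mem (commutatorElement_mem_center hclass x y) _
  have hmul (a b c d : G) : (⁅a, b⁆ * ⁅c, d⁆) ^ (k + 1) = ⁅a, b⁆ ^ (k + 1) * ⁅c, d⁆ ^ (k + 1) :=
    Commute.mul_pow (Subgroup.mem_center_iff.1 (commutatorElement_mem_center hclass c d) _) _
  change baerSum k x y * z * ⁅z, baerSum k x y⁆ ^ (k + 1) =
    x * baerSum k y z * ⁅baerSum k y z, x⁆ ^ (k + 1)
  rw [commutatorElement_baerSum_right hclass, commutatorElement_baerSum_left hclass, hmul, hmul,
    baerSum, baerSum]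
  have hyx := Subgroup.mem_center_iff.1 (hpow y x) z
  have hzy := Subgroup.mem_center_iff.1 (hpow z y) (⁅y, x⁆ ^ (k + 1) * ⁅z, x⁆ ^ (k + 1))
  generalize ⁅y, x⁆ ^ (k + 1) = a, ⁅z, x⁆ ^ (k + 1) = b, ⁅z, y⁆ ^ (k + 1) = c at hyx hzy ⊢
  calc x * y * a * z * (b * c) = x * y * (a * z) * (b * c) := by rw [mul_assoc (x * y) a z]
    _ = x * y * z * (a * b * c) := by rw [← hyx]; simp only [mul_assoc]
    _ = x * (y * z * c) * (a * b) := by rw [hzy]; simp only [mul_assoc]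

/-- The abelian group structure on a group of class two and odd exponent given by Baer's sum. -/
abbrev baerAddCommGroup {k : ℕ} (hexp : ∀ g : G, g ^ (2 * k + 1) = 1)
    (hclass : commutator G ≤ Subgroup.center G) : AddCommGroup G where
  add := baerSum k
  zero := 1
  neg x := x⁻¹
  add_assoc := baerSum_assoc hclass k
  zero_add x := show baerSum k 1 x = x by simp [baerSum]
  add_zero x := show baerSum k x 1 = x by simp [baerSum]
  add_comm := baerSum_comm hexp hclass
  neg_add_cancel x := show baerSum k x⁻¹ x = 1 by
    simp [baerSum, (Commute.refl x).inv_right.commutator_eq]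
  nsmul n x := x ^ n
  nsmul_zero := pow_zero
  nsmul_succ n x := show x ^ (n + 1) = baerSum k (x ^ n) x by
    simp [baerSum, (Commute.self_pow x n).commutator_eq, pow_succ]
  zsmul n x := x ^ n
  zsmul_zero' := zpow_zero
  zsmul_succ' n x := show x ^ (n.succ : ℤ) = baerSum k (x ^ (n : ℤ)) x by
    simp only [zpow_natCast, baerSum, (Commute.self_pow x n).commutator_eq, pow_succ, one_pow,
      mul_one]
  zsmul_neg' n x := show x ^ Int.negSucc n = (x ^ (n.succ : ℤ))⁻¹ by
    rw [zpow_negSucc, zpow_natCast]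

theorem exists_bilinear_of_pow_eq_one {p : ℕ} [Fact p.Prime] (hodd : Odd p)
    (hexp : ∀ g : G, g ^ p = 1) (hclass : commutator G ≤ Subgroup.center G) :
    ∃ (_ : AddCommGroup G) (_ : Module (ZMod p) G) (B : G →ₗ[ZMod p] G →ₗ[ZMod p] G),
      B.IsAlt ∧ (∀ x y, B x y ∈ LinearMap.ker B) ∧
        ∀ x y, x * y = x + y + (2 : ZMod p)⁻¹ • B x y := by
  obtain ⟨k, rfl⟩ := hodd
  let _ : AddCommGroup G := baerAddCommGroup hexp hclass
  let _ : Module (ZMod (2 * k + 1)) G := AddCommGroup.zmodModule hexp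
  have hcenter := commutatorElement_mem_center hclass
  have hadd {z : G} (hz : z ∈ Subgroup.center G) (x : G) : x + z = x * z :=
    show baerSum k x z = x * z by
      rw [baerSum, commutatorElement_eq_one_of_mem_center_left hz, one_pow, mul_one]
  have hhalf : (2 : ZMod (2 * k + 1))⁻¹ = (k + 1 : ℕ) := by
    refine inv_eq_of_mul_eq_one_right ?_
    have h : ((2 * k + 1 : ℕ) : ZMod (2 * k + 1)) = 0 := ZMod.natCast_self _
    push_cast at h ⊢
    linear_combination h
  let B : G →+ G →+ G := AddMonoidHom.mk'
    (fun x ↦ AddMonoidHom.mk' (fun y ↦ ⁅x, y⁆) fun y z ↦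
      (commutatorElement_baerSum_right hclass k x y z).trans (hadd (hcenter x z) _).symm)
    fun x y ↦ AddMonoidHom.ext fun z ↦
      (commutatorElement_baerSum_left hclass k x y z).trans (hadd (hcenter y z) _).symm
  let toLinear := (AddMonoidHom.toZModLinearMapEquiv (2 * k + 1) (M := G) (M₁ := G)).toAddMonoidHom
  refine ⟨inferInstance, inferInstance, (toLinear.comp B).toZModLinearMap _,
    commutatorElement_self, fun x y ↦ LinearMap.ext fun z ↦
      commutatorElement_eq_one_of_mem_center_left (hcenter x y), fun x y ↦ ?_⟩
  change x * y = baerSum k x y + (2 : ZMod (2 * k + 1))⁻¹ • ⁅x, y⁆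
  rw [hhalf, Nat.cast_smul_eq_nsmul]
  change x * y = baerSum k x y + ⁅x, y⁆ ^ (k + 1)
  rw [hadd (pow_mem (hcenter x y) _), baerSum, mul_assoc (x * y), ← commutatorElement_inv x y,
    inv_pow, inv_mul_cancel, mul_one]

end Baer

section BaerCorrespondence

variable {F L : Type*} [Field F] [AddCommGroup L] [Module F L] {B : L →ₗ[F] L →ₗ[F] L}

/-- The bilinear map between subspaces obtained by restricting a bilinear map with values in `W`. -/
def restrictBilinear (B : L →ₗ[F] L →ₗ[F] L) (V : Submodule F L) {W : Submodule F L}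
    (hW : ∀ x y, B x y ∈ W) : V →ₗ[F] V →ₗ[F] W :=
  LinearMap.mk₂ F (fun v v' ↦ ⟨B v v', hW v v'⟩) (by intros; ext; simp) (by intros; ext; simp)
    (by intros; ext; simp) (by intros; ext; simp)

theorem apply_eq_zero_of_mem_ker_right (hB : B.IsAlt) {x w : L} (hw : w ∈ LinearMap.ker B) :
    B x w = 0 := by
  rw [← hB.neg, LinearMap.mem_ker.1 hw, LinearMap.zero_apply, neg_zero]

theorem ker_restrictBilinear (hB : B.IsAlt) (hBB : ∀ x y, B x y ∈ LinearMap.ker B)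
    {V : Submodule F L} (hV : IsCompl V (LinearMap.ker B)) :
    LinearMap.ker (restrictBilinear B V hBB) = ⊥ := by
  refine LinearMap.ker_eq_bot'.2 fun v hv ↦ Subtype.ext ?_
  refine Submodule.disjoint_def.1 hV.disjoint v v.2 (LinearMap.mem_ker.2 (LinearMap.ext fun x ↦ ?_))
  obtain ⟨⟨v', w⟩, rfl⟩ := (V.prodEquivOfIsCompl _ hV).surjective x
  have h : B v v' = 0 := congrArg Subtype.val (LinearMap.congr_fun hv v')
  simp [h, apply_eq_zero_of_mem_ker_right hB w.2]

theorem nonempty_mulEquiv_heisenbergGroup {G : Type*} [Group G] (e : L ≃ G) (hB : B.IsAlt)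
    (hBB : ∀ x y, B x y ∈ LinearMap.ker B)
    (he : ∀ x y, e x * e y = e (x + y + (2 : F)⁻¹ • B x y)) {V : Submodule F L}
    (hV : IsCompl V (LinearMap.ker B)) :
    Nonempty (HeisenbergGroup (restrictBilinear B V hBB) ≃* G) := by
  let f : HeisenbergGroup (restrictBilinear B V hBB) ≃ V × LinearMap.ker B :=
    ⟨fun x ↦ (x.base, x.fiber), fun y ↦ ⟨y.1, y.2⟩, fun _ ↦ rfl, fun _ ↦ rfl⟩
  refine ⟨.mk' (f.trans ((V.prodEquivOfIsCompl _ hV).toEquiv.trans e)) fun x y ↦ ?_⟩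
  have hval : B (x.base + x.fiber) (y.base + y.fiber) = B x.base y.base := by
    rw [map_add B, LinearMap.add_apply, LinearMap.mem_ker.1 x.fiber.2, LinearMap.zero_apply,
      add_zero, map_add, apply_eq_zero_of_mem_ker_right hB y.fiber.2, add_zero]
  change e (↑(x.base + y.base) + ↑(x.fiber + y.fiber + _)) =
    e (x.base + x.fiber) * e (y.base + y.fiber)
  rw [he, hval]
  congr 1
  simp only [restrictBilinear, Submodule.coe_add, Submodule.coe_smul, LinearMap.mk₂_apply]
  abel

theorem exists_mulEquiv_heisenbergGroup.{u} {p : ℕ} [Fact p.Prime] {G : Type u} [Group G]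
    (hodd : Odd p) (hexp : ∀ g : G, g ^ p = 1) (hclass : commutator G ≤ Subgroup.center G) :
    ∃ (V W : Type u) (_ : AddCommGroup V) (_ : Module (ZMod p) V) (_ : AddCommGroup W)
      (_ : Module (ZMod p) W) (β : V →ₗ[ZMod p] V →ₗ[ZMod p] W),
      β.IsAlt ∧ LinearMap.ker β = ⊥ ∧ Nonempty (HeisenbergGroup β ≃* G) := by
  obtain ⟨_, _, B, hB, hBB, hmul⟩ := exists_bilinear_of_pow_eq_one hodd hexp hclass
  obtain ⟨V, hV⟩ := (LinearMap.ker B).exists_isCompl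
  exact ⟨V, LinearMap.ker B, _, _, _, _, restrictBilinear B V hBB,
    fun v ↦ Subtype.ext (hB v), ker_restrictBilinear hB hBB hV.symm,
    nonempty_mulEquiv_heisenbergGroup (Equiv.refl G) hB hBB hmul hV.symm⟩

end BaerCorrespondence

section CommutatorPairing

open scoped commutatorElement IsMulCommutative

variable {K H : Type*} [Group K] [Group H] {q : K →* H}

theorem commutatorElement_eq_of_map_eq (hker : q.ker ≤ Subgroup.center K) {k k' l l' : K}
    (hk : q k = q k') (hl : q l = q l') : ⁅k, l⁆ = ⁅k', l'⁆ := by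
  have hcenter {a b : K} (h : q a = q b) : b⁻¹ * a ∈ Subgroup.center K :=
    hker (by rw [MonoidHom.mem_ker, map_mul, map_inv, h, inv_mul_cancel])
  have hz (x : K) : ⁅k'⁻¹ * k, x⁆ = 1 := commutatorElement_eq_one_of_mem_center_left (hcenter hk)
  have hu : ⁅k', l'⁻¹ * l⁆ = 1 := commutatorElement_eq_one_of_mem_center_right (hcenter hl)
  rw [← mul_inv_cancel_left k' k, ← mul_inv_cancel_left l' l,
    commutatorElement_mul_left_of_mem_center (by rw [hz]; exact one_mem _), hz, mul_one,
    commutatorElement_mul_right_of_mem_center (by rw [hu]; exact one_mem _), hu, mul_one]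

theorem commutatorElement_mem_center_of_map_mem_center (hker : q.ker = Subgroup.center K) {k : K}
    (hk : q k ∈ Subgroup.center H) (l : K) : ⁅k, l⁆ ∈ Subgroup.center K := by
  rw [← hker, MonoidHom.mem_ker, map_commutatorElement,
    commutatorElement_eq_one_of_mem_center_left hk]

/-- The pairing `(z, x) ↦ ⁅k, l⁆` of `Subgroup.center H` with `H`, where `k` and `l` are lifts of
`z` and `x` along a surjection `q : K →* H` with kernel `Subgroup.center K`. -/
noncomputable def commutatorPairing (hq : Function.Surjective q)
    (hker : q.ker = Subgroup.center K) : Subgroup.center H →* H →* Subgroup.center K :=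
  have hmem (z : Subgroup.center H) : q (Function.surjInv hq z) ∈ Subgroup.center H := by
    rw [Function.surjInv_eq hq]
    exact z.2
  .mk' (fun z ↦ .mk' (fun x ↦ ⟨⁅Function.surjInv hq z, Function.surjInv hq x⁆,
      commutatorElement_mem_center_of_map_mem_center hker (hmem z) _⟩)
    fun x y ↦ Subtype.ext <| by
      rw [Subgroup.coe_mul, ← commutatorElement_mul_right_of_mem_center
        (commutatorElement_mem_center_of_map_mem_center hker (hmem z) _)]
      exact commutatorElement_eq_of_map_eq hker.le rfl (by simp [Function.surjInv_eq]))
    fun z z' ↦ MonoidHom.ext fun x ↦ Subtype.ext <| by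
      refine Eq.trans ?_ (commutatorElement_mul_left_of_mem_center
        (commutatorElement_mem_center_of_map_mem_center hker (hmem z') _))
      exact commutatorElement_eq_of_map_eq hker.le (by simp [Function.surjInv_eq]) rfl

variable (hq : Function.Surjective q) (hker : q.ker = Subgroup.center K)

theorem commutatorPairing_apply {z : Subgroup.center H} {x : H} {k l : K} (hk : q k = z)
    (hl : q l = x) : (commutatorPairing hq hker z x : K) = ⁅k, l⁆ :=
  commutatorElement_eq_of_map_eq hker.le (by rw [Function.surjInv_eq hq, hk])
    (by rw [Function.surjInv_eq hq, hl])

theorem commutatorPairing_injective : Function.Injective (commutatorPairing hq hker) := by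
  refine (injective_iff_map_eq_one _).2 fun z hz ↦ Subtype.ext ?_
  obtain ⟨k, hk⟩ := hq z
  rw [← hk, OneMemClass.coe_one, ← MonoidHom.mem_ker, hker, Subgroup.mem_center_iff]
  intro l
  have hkl := commutatorPairing_apply hq hker hk (rfl : q l = q l)
  rw [hz] at hkl
  exact (commutatorElement_eq_one_iff_mul_comm.1 hkl.symm).symm

theorem commutatorPairing_swap (z z' : Subgroup.center H) :
    commutatorPairing hq hker z z' = (commutatorPairing hq hker z' z)⁻¹ := by
  obtain ⟨k, hk⟩ := hq z
  obtain ⟨k', hk'⟩ := hq z'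
  refine Subtype.ext ?_
  rw [InvMemClass.coe_inv, commutatorPairing_apply hq hker hk hk',
    commutatorPairing_apply hq hker hk' hk, commutatorElement_inv]

theorem commutatorPairing_jacobi {z₁ z₂ z₃ : Subgroup.center H} {a b c : H} (h₁ : z₁ = ⁅a, b⁆)
    (h₂ : z₂ = ⁅b, c⁆) (h₃ : z₃ = ⁅c, a⁆) :
    commutatorPairing hq hker z₁ c * commutatorPairing hq hker z₂ a *
      commutatorPairing hq hker z₃ b = 1 := by
  obtain ⟨k, rfl⟩ := hq a
  obtain ⟨l, rfl⟩ := hq b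
  obtain ⟨m, rfl⟩ := hq c
  have hconj {z : Subgroup.center H} {x y v : K} (hz : z = ⁅q x, q y⁆) :
      (commutatorPairing hq hker z (q v) : K) = ⁅⁅x, y⁆, y * v * y⁻¹⁆ := by
    rw [← commutatorPairing_apply hq hker (z := z) (by rw [map_commutatorElement, hz]) rfl]
    simp only [map_mul, map_inv, mul_inv_cancel_comm]
  refine Subtype.ext ?_
  rw [Subgroup.coe_mul, Subgroup.coe_mul, hconj h₁, hconj h₂, hconj h₃]
  exact commutatorElement_commutatorElement_conj_mul k l m

end CommutatorPairing

section CapableHeisenberg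

open scoped commutatorElement IsMulCommutative

variable {p : ℕ} [Fact p.Prime] {V W : Type*} [AddCommGroup V] [Module (ZMod p) V]
  [AddCommGroup W] [Module (ZMod p) W]

attribute [local instance] AddSubgroup.torsionBy.zmodModule

/-- A biadditive map on `ZMod p`-modules, as a bilinear map into the `p`-torsion of its target. -/
def torsionBilinear {A : Type*} [AddCommGroup A] (T : W →+ V →+ A) :
    W →ₗ[ZMod p] V →ₗ[ZMod p] AddSubgroup.torsionBy A p :=
  have hmem (w : W) (v : V) : T w v ∈ AddSubgroup.torsionBy A p := by
    rw [AddSubgroup.torsionBy.nsmul_iff, ← map_nsmul, ← Nat.cast_smul_eq_nsmul (ZMod p) p v,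
      ZMod.natCast_self, zero_smul, map_zero]
  let T' : W →+ V →ₗ[ZMod p] AddSubgroup.torsionBy A p :=
    .mk' (fun w ↦ ((T w).codRestrict _ (hmem w)).toZModLinearMap p) fun w w' ↦
      LinearMap.ext fun v ↦ Subtype.ext (DFunLike.congr_fun (map_add T w w') v)
  T'.toZModLinearMap p

theorem coe_torsionBilinear {A : Type*} [AddCommGroup A] (T : W →+ V →+ A) (w : W) (v : V) :
    (torsionBilinear (p := p) T w v : A) = T w v := rfl

variable {β : V →ₗ[ZMod p] V →ₗ[ZMod p] W}

namespace HeisenbergGroup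

theorem map_mk_add {F V W : Type*} [Field F] [AddCommGroup V] [Module F V] [AddCommGroup W]
    [Module F W] {β : V →ₗ[F] V →ₗ[F] W} (h2 : (2 : F) ≠ 0) (hβ : β.IsAlt) {A : Type*}
    [CommGroup A] (φ : HeisenbergGroup β →* A) (v v' : V) :
    φ ⟨v + v', 0⟩ = φ ⟨v, 0⟩ * φ ⟨v', 0⟩ := by
  have hcomm : φ ⁅(⟨(2 : F)⁻¹ • v, 0⟩ : HeisenbergGroup β), ⟨v', 0⟩⁆ = 1 := by
    rw [map_commutatorElement, commutatorElement_eq_one_iff_mul_comm, mul_comm]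
  rw [← map_mul, ← mul_one (φ ⟨v + v', 0⟩), ← hcomm, ← map_mul, commutatorElement_eq h2 hβ]
  congr 1
  ext
  · simp [incl]
  · simp [incl]

/-- The restriction of a pairing of the center of a Heisenberg group with the whole group to the
fiber and the base. -/
def fiberBasePairing (h2 : (2 : ZMod p) ≠ 0) (hβ : β.IsAlt) {A : Type*} [CommGroup A]
    (P : Subgroup.center (HeisenbergGroup β) →* HeisenbergGroup β →* A) : W →+ V →+ Additive A :=
  .mk' (fun w ↦ .mk' (fun v ↦ .ofMul (P (inclCenter β (.ofAdd w)) ⟨v, 0⟩))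
      fun _ _ ↦ congrArg Additive.ofMul (map_mk_add h2 hβ _ _ _))
    fun w w' ↦ AddMonoidHom.ext fun v ↦ congrArg Additive.ofMul
      (DFunLike.congr_fun (map_mul (P.comp (inclCenter β)) (.ofAdd w) (.ofAdd w')) ⟨v, 0⟩)

variable (h2 : (2 : ZMod p) ≠ 0) (hβ : β.IsAlt) {K : Type*} [Group K] {q : K →* HeisenbergGroup β}
  (hq : Function.Surjective q) (hker : q.ker = Subgroup.center K)

theorem isJacobiForm_torsionBilinear_commutatorPairing :
    IsJacobiForm β (torsionBilinear (fiberBasePairing h2 hβ (commutatorPairing hq hker))) := by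
  intro a b c
  have hfiber (v v' : V) : (inclCenter β (.ofAdd (β v v')) : HeisenbergGroup β) =
      ⁅(⟨v, 0⟩ : HeisenbergGroup β), ⟨v', 0⟩⁆ :=
    (commutatorElement_eq h2 hβ ⟨v, 0⟩ ⟨v', 0⟩).symm
  exact Subtype.ext (congrArg Additive.ofMul
    (commutatorPairing_jacobi hq hker (hfiber a b) (hfiber b c) (hfiber c a)))

theorem eq_zero_of_fiberBasePairing_eq_zero {w : W} (hw : w ∈ valueSpan β)
    (h : fiberBasePairing h2 hβ (commutatorPairing hq hker) w = 0) : w = 0 := by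
  let z (u : W) : Subgroup.center (HeisenbergGroup β) := inclCenter β (.ofAdd u)
  have hcomm : (z w : HeisenbergGroup β) ∈ commutator (HeisenbergGroup β) := by
    rw [commutator_eq h2 hβ]
    exact Subgroup.mem_map_of_mem _ hw
  have hfiber (u : W) : commutatorPairing hq hker (z w) (z u) = 1 := by
    rw [commutatorPairing_swap, inv_eq_one]
    exact Abelianization.commutator_subset_ker _ hcomm
  have hbase (v : V) : commutatorPairing hq hker (z w) ⟨v, 0⟩ = 1 :=
    congrArg Additive.toMul (DFunLike.congr_fun h v)
  have hone : commutatorPairing hq hker (z w) = 1 := by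
    ext1 x
    have hx : x = z x.fiber * ⟨x.base, 0⟩ :=
      HeisenbergGroup.ext (by simp [z, inclCenter, incl]) (by simp [z, inclCenter, incl])
    rw [hx, map_mul, hbase, mul_one, hfiber, MonoidHom.one_apply]
  rw [map_eq_one_iff _ (commutatorPairing_injective hq hker)] at hone
  exact incl_injective β (congrArg Subtype.val hone)

end HeisenbergGroup

theorem detectedByJacobiForm_of_isCapable (h2 : (2 : ZMod p) ≠ 0) (hβ : β.IsAlt)
    (hcap : IsCapable (HeisenbergGroup β)) {w : W} (hw : w ∈ valueSpan β) (hw0 : w ≠ 0) :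
    DetectedByJacobiForm β w := by
  obtain ⟨K, _, q, hq, hker⟩ := hcap.exists_surjective
  let T := HeisenbergGroup.fiberBasePairing h2 hβ (commutatorPairing hq hker)
  obtain ⟨v, hv⟩ : ∃ v, T w v ≠ 0 := by
    by_contra! hzero
    exact hw0 (HeisenbergGroup.eq_zero_of_fiberBasePairing_eq_zero h2 hβ hq hker hw
      (AddMonoidHom.ext hzero))
  obtain ⟨ψ, hψ⟩ : ∃ ψ : Dual (ZMod p) (AddSubgroup.torsionBy _ _),
      ψ (torsionBilinear T w v) ≠ 0 := by
    by_contra! hzero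
    rw [← coe_torsionBilinear (p := p), (forall_dual_apply_eq_zero_iff (ZMod p) _).1 hzero] at hv
    exact hv rfl
  refine ⟨(torsionBilinear T).compr₂ ψ, fun a b c ↦ ?_,
    fun hzero ↦ hψ (LinearMap.congr_fun hzero v)⟩
  have hjacobi := HeisenbergGroup.isJacobiForm_torsionBilinear_commutatorPairing h2 hβ hq hker a b c
  simp only [LinearMap.compr₂_apply, ← map_add]
  exact (congrArg ψ hjacobi).trans (map_zero ψ)

end CapableHeisenberg

section HeisenbergCocycles

variable {F V W : Type*} [Field F] [AddCommGroup V] [Module F V] [AddCommGroup W] [Module F W]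
  [FiniteDimensional F V] {β : V →ₗ[F] V →ₗ[F] W} {τ : W →ₗ[F] V →ₗ[F] F}

theorem IsJacobiForm.exists_twoCocycle (h2 : (2 : F) ≠ 0) (hτ : IsJacobiForm β τ) :
    ∃ c : TwoCocycle (HeisenbergGroup β) F,
      ∀ w v, c.toFun ⟨0, w⟩ ⟨v, 0⟩ - c.toFun ⟨v, 0⟩ ⟨0, w⟩ = τ w v := by
  obtain ⟨κ, hκ⟩ := Submodule.smul_mem _ (2 : F)⁻¹ (hτ.mem_range_coboundary h2)
  replace hκ (x y z : V) :
      κ y z - κ (x + y) z + κ x (y + z) - κ x y = (2 : F)⁻¹ * τ (β x y) z :=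
    congrFun (congrFun (congrFun hκ x) y) z
  refine ⟨⟨fun x y ↦ τ x.fiber y.base + κ x.base y.base, fun x y z ↦ ?_⟩, fun w v ↦ ?_⟩
  · have h := hκ x.base y.base z.base
    simp only [HeisenbergGroup.mul_base, HeisenbergGroup.mul_fiber, map_add, map_smul,
      LinearMap.add_apply, LinearMap.smul_apply, smul_eq_mul]
    linear_combination -h
  · have hleft := hκ 0 0 v
    have hright := hκ v 0 0
    simp only [add_zero, zero_add, map_zero, LinearMap.zero_apply, mul_zero] at hleft hright
    simp only [map_zero]
    linear_combination hright + hleft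

end HeisenbergCocycles

theorem isCapable_heisenbergGroup_of_detectedByJacobiForm.{u, v} {F : Type v} {V W : Type (max u v)}
    [Field F] [AddCommGroup V] [Module F V] [FiniteDimensional F V] [AddCommGroup W] [Module F W]
    {β : V →ₗ[F] V →ₗ[F] W} (h2 : (2 : F) ≠ 0) (hβ : β.IsAlt) (hker : LinearMap.ker β = ⊥)
    (hdet : ∀ w, w ≠ 0 → DetectedByJacobiForm β w) : IsCapable (HeisenbergGroup β) := by
  refine isCapable_of_forall_exists_twoCocycle.{u, v} (A := F) fun z hz hz1 ↦ ?_
  have hbase := (HeisenbergGroup.mem_center_iff h2 hβ hker).1 hz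
  have hfiber : z.fiber ≠ 0 := fun h ↦ hz1 (HeisenbergGroup.ext hbase h)
  obtain ⟨τ, hτ, hw⟩ := hdet z.fiber hfiber
  obtain ⟨c, hc⟩ := hτ.exists_twoCocycle h2
  obtain ⟨v, hv⟩ := DFunLike.ne_iff.1 hw
  refine ⟨c, ⟨v, 0⟩, fun heq ↦ hv ?_⟩
  have hz' : z = ⟨0, z.fiber⟩ := HeisenbergGroup.ext hbase rfl
  rw [← hc, ← hz', heq, sub_self, LinearMap.zero_apply]

theorem two_ne_zero_zmod_of_odd {p : ℕ} [Fact p.Prime] (hodd : Odd p) : (2 : ZMod p) ≠ 0 := by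
  refine Ring.two_ne_zero ?_
  rw [ZMod.ringChar_zmod_n]
  rintro rfl
  exact absurd hodd (by decide)

section MulEquiv

variable {G H : Type*} [Group G] [Group H]

theorem map_center_mulEquiv (f : G ≃* H) :
    (Subgroup.center G).map (f : G →* H) = Subgroup.center H := by
  ext y
  obtain ⟨x, rfl⟩ := f.surjective y
  simp only [Subgroup.mem_map, Subgroup.mem_center_iff, MonoidHom.coe_coe,
    EmbeddingLike.apply_eq_iff_eq, exists_eq_right, f.surjective.forall, ← map_mul]

theorem rank_quotient_center_congr [Finite G] [Finite H] (f : G ≃* H) :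
    Group.rank (G ⧸ Subgroup.center G) = Group.rank (H ⧸ Subgroup.center H) :=
  Group.rank_congr (QuotientGroup.congr _ _ f (map_center_mulEquiv f))

theorem rank_commutator_congr [Finite G] [Finite H] (f : G ≃* H) :
    Group.rank (commutator G) = Group.rank (commutator H) := by
  have hmap : (commutator G).map (f : G →* H) = commutator H := by
    rw [map_commutator_eq, MonoidHom.range_eq_top_of_surjective _ f.surjective, commutator_def]
  exact Group.rank_congr ((f.subgroupMap _).trans (MulEquiv.subgroupCongr hmap))

end MulEquiv

theorem mainTheorem2 (p : ℕ) (hp : p.Prime) (hodd : Odd p)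
    (G : Type*) [Group G] [Finite G]
    (hexp : Monoid.exponent G = p)
    (hclass : commutator G ≤ Subgroup.center G)
    (n m : ℕ)
    (hn : Group.rank (G ⧸ Subgroup.center G) = n)
    (hm : Group.rank (commutator G) = m) :
    (IsCapable G → n ≤ 2 * m + m.choose 2) ∧
    (overlapBound (n.choose 2 - m + 1) < n → IsCapable G) := by
  have : Fact p.Prime := ⟨hp⟩
  have h2 : (2 : ZMod p) ≠ 0 := two_ne_zero_zmod_of_odd hodd
  obtain ⟨V, W, _, _, _, _, β, hβ, hker, ⟨f⟩⟩ :=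
    exists_mulEquiv_heisenbergGroup hodd (fun g ↦ hexp ▸ Monoid.pow_exponent_eq_one g) hclass
  have : Finite (HeisenbergGroup β) := .of_equiv G f.symm.toEquiv
  have : Finite V := .of_surjective _ (HeisenbergGroup.proj_surjective β)
  have : Finite W := .of_injective _ (HeisenbergGroup.incl_injective β)
  have hV : finrank (ZMod p) V = n := by
    rw [← hn, ← rank_quotient_center_congr f, ← rank_multiplicative_eq_finrank]
    exact (Group.rank_congr (HeisenbergGroup.quotientCenterEquiv h2 hβ hker)).symm
  have hspan : finrank (ZMod p) (valueSpan β) = m := by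
    rw [← hm, ← rank_commutator_congr f, HeisenbergGroup.rank_commutator h2 hβ]
  subst hV hspan
  refine ⟨fun hG ↦ ?_, fun hlt ↦ ?_⟩
  · have hle := finrank_le_of_detectedByJacobiForm hβ fun w hw hw0 ↦
      detectedByJacobiForm_of_isCapable h2 hβ (hG.of_mulEquiv f.symm) hw hw0
    rwa [hker, finrank_bot, zero_add] at hle
  · exact (isCapable_heisenbergGroup_of_detectedByJacobiForm h2 hβ hker fun w hw ↦
      detectedByJacobiForm_of_overlapBound_lt h2 hβ hlt hw).of_mulEquiv f
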